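/- **Setting.** Let $d\ge 1$ and let $r_1,\dots,r_d\ge 0$ and $k\ge 0$ be integers with $r_{i+1}\ge 2r_i$ for $1\le i<d$ and $k\ge 2r_d+1$. Put $\mathcal D_d=\{0,\dots,d\}$ and let $\Sigma(d,k)$ be the set of multi-indices $\alpha=(\alpha_0,\dots,\alpha_d)$ of nonnegative integers with $\sum_i\alpha_i=k$. For $s=d,d-1,\dots,0$ successively, let $\Sigma'_s(d,k)$ be the set of all $\alpha\in\Sigma(d,k)\setminus\bigcup_{s<s'\le d}\Sigma'_{s'}(d,k)$ such that for each $1\le t\le s$ there is $N_t\subseteq\mathcal D_d$ with $\#N_t=t$ and $\sum_{i\in N_t}\alpha_i\le r_t$. For $\alpha\in\Sigma'_s(d,k)$ let $N'(\alpha)\subseteq\mathcal D_d$ be a set with $\#N'(\alpha)=s$ and $\sum_{i\in N'(\alpha)}\alpha_i\le r_s$ (no condition on the sum if $s=0$; such a set exists and is unique), and put $\Delta'(\alpha)=\mathcal D_d\setminus N'(\alpha)$ and $n'(\alpha)=\sum_{i\in N'(\alpha)}\alpha_i$. Let $K\subset\mathbb R^d$ be a nondegenerate simplex with vertices $x_0,\dots,x_d$,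 and let $\mathcal P_k(K)$ be the space of polynomials of total degree at most $k$ on $K$. For $\alpha\in\Sigma'_s(d,k)$ let $c=r_{s+1}-n'(\alpha)+1$ if $s<d$; the *node* $L_\alpha\in K$ is the point with barycentric coordinates $$\lambda_i=\frac{\alpha_i-c+1}{\,k-n'(\alpha)-(d+1-s)c+\#\Delta'(\alpha)\,}\ \ (i\in\Delta'(\alpha)),\qquad \lambda_i=0\ \ (i\in N'(\alpha)),$$ and if $s=d$ the node is the vertex $x_i$ with $\Delta'(\alpha)=\{i\}$. For $i\in N'(\alpha)$ let $m_i=m_i^{\alpha}$ be the outer unit normal vector of the simplex with vertices $x_j$, $j\in\Delta'(\alpha)$, as a face of the simplex with vertices $x_j$, $j\in\Delta'(\alpha)\cup\{i\}$. For $u\in C^{r_d}(K)$ define the degrees of freedom $$\psi^K_\alpha(u)=\frac{\partial^{\,n'(\alpha)}u}{\prod_{i\in N'(\alpha)}\partial m_i^{\alpha_i}}(L_\alpha),\qquad \alpha\in\Sigma(d,k).$$ A *mesh* $\mathcal T$ is a locally finite (for instance finite) simplicial complex in $\mathbb R^d$ all of whose simplices are faces of $d$-dimensional simplices of the complex, the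 *elements*; $\Omega$ is the union of the elements. For this closed set $\Omega$, $C^m(\Omega)$ is the space of functions on $\Omega$ that have continuous derivatives up to order $m$ on $\Omega$, one-sided at boundary points. **Theorem 3.1.** (a) For every nondegenerate simplex $K\subset\mathbb R^d$ the degrees of freedom $\psi^K_\alpha$, $\alpha\in\Sigma(d,k)$, are unisolvent for $\mathcal P_k(K)$: the map $u\mapsto(\psi^K_\alpha(u))_\alpha$ is a bijection from $\mathcal P_k(K)$ onto $\mathbb R^{\Sigma(d,k)}$. There are $p^K_\alpha\in\mathcal P_k(K)$, $\alpha\in\Sigma(d,k)$, with $$\sum_{\alpha\in\Sigma(d,k)}\psi^K_\alpha(u)\,p^K_\alpha=u\qquad\text{for all }u\in\mathcal P_k(K).$$ (b) Let $\mathcal T$ be a mesh of $\Omega$, with the vertices of each element numbered $0,\dots,d$ in any way, and let $u\in C^{r_d}(\Omega)$. For every choice of polynomials $p^K_\alpha$ as in (a), the local interpolants $$\mathcal I_Ku=\sum_{\alpha\in\Sigma(d,k)}\psi^K_\alpha(u)\,p^K_\alpha\in\mathcal P_k(K)$$ agree where elements meet, and the function $\mathcal I_{\mathcal T}u$ on $\Omega$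 defined by $(\mathcal I_{\mathcal T}u)|_K=\mathcal I_Ku$ for every element $K$ of $\mathcal T$ is in $C^{r_1}(\Omega)$. -/

import Mathlib

noncomputable section

namespace CrInterp

/-- The Euclidean space `ℝ^d`. -/
abbrev E (d : ℕ) : Type := EuclideanSpace ℝ (Fin d)

/-! Throughout, a vector `(r_1, …, r_d)` of nonnegative integers is given by a function `r : ℕ → ℕ`,
of which only the values at `1, …, d` are used. The index set `{0, …, d}` is `Fin (d + 1)`. -/

/-! ### Polynomials -/

/-- The function on `ℝ^d` of a polynomial in `d` variables, as a linear map. -/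
def polyFun (d : ℕ) : MvPolynomial (Fin d) ℝ →ₗ[ℝ] (E d → ℝ) where
  toFun p := fun y => MvPolynomial.eval (fun j => y j) p
  map_add' p q := by ext y; simp
  map_smul' c p := by ext y; simp

/-- The polynomial functions of total degree at most `k`. A polynomial is determined by its values
on a nondegenerate simplex `K`, so this is also the space of polynomials of degree at most `k`
on `K`. -/
def polySpace (d k : ℕ) : Submodule ℝ (E d → ℝ) :=
  (MvPolynomial.restrictTotalDegree (Fin d) ℝ k).map (polyFun d)

/-! ### The dual decomposition of the set of multi-indices -/

/-- The multi-indices `(α_0, …, α_d)` of nonnegative integers with sum `k`. -/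
def multiIndex (d k : ℕ) : Finset (Fin (d + 1) → ℕ) :=
  Finset.piAntidiag Finset.univ k

/-- The multi-indices `α` with sum `k` such that for each `1 ≤ t ≤ s` there is a set `N_t` of `t`
indices with `∑ i ∈ N_t, α_i ≤ r_t`. -/
def smallUpTo (d k : ℕ) (r : ℕ → ℕ) (s : ℕ) : Set (Fin (d + 1) → ℕ) :=
  {α | α ∈ multiIndex d k ∧ ∀ t, 1 ≤ t → t ≤ s →
    ∃ N : Finset (Fin (d + 1)), N.card = t ∧ ∑ i ∈ N, α i ≤ r t}

/-- The `s`-th set `Σ'_s` of the dual decomposition, `0 ≤ s ≤ d`, in closed form; the downward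
recursion `Σ'_s = smallUpTo s \ ⋃_{s < s' ≤ d} Σ'_{s'}` is `dualLayer_eq`. -/
def dualLayer (d k : ℕ) (r : ℕ → ℕ) (s : ℕ) : Set (Fin (d + 1) → ℕ) :=
  smallUpTo d k r s \ ⋃ s' ∈ Set.Ioc s d, smallUpTo d k r s'

theorem dualLayer_eq (d k : ℕ) (r : ℕ → ℕ) (s : ℕ) :
    dualLayer d k r s = smallUpTo d k r s \ ⋃ s' ∈ Set.Ioc s d, dualLayer d k r s' := by
  classical
  ext α
  simp only [dualLayer, Set.mem_sdiff, Set.mem_iUnion, not_exists, Set.mem_Ioc, exists_prop,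
    not_and, not_forall, not_not]
  refine and_congr_right fun _ => ⟨fun h t ht ht' => absurd ht' (h t ht), fun h t ht ht' => ?_⟩
  -- the largest index `m` in `(s, d]` with `α ∈ smallUpTo m` gives a contradiction
  let F := (Finset.Ioc s d).filter fun m => α ∈ smallUpTo d k r m
  have hF : F.Nonempty := ⟨t, by simp [F, ht, ht']⟩
  have hm := F.max'_mem hF
  simp only [F, Finset.mem_filter, Finset.mem_Ioc] at hm
  obtain ⟨u, hu, hu'⟩ := h _ hm.1 hm.2
  have : u ≤ F.max' hF := F.le_max' u (by simp only [F, Finset.mem_filter, Finset.mem_Ioc]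
                                          exact ⟨⟨hm.1.1.trans hu.1, hu.2⟩, hu'⟩)
  exact absurd hu.1 (not_lt.mpr this)

/-- `N` is an admissible choice for `N'(α)`: with `s = card N`, the multi-index `α` is in `Σ'_s`
and `∑ i ∈ N, α_i ≤ r_s` (no condition if `s = 0`, as the sum is then empty). -/
def IsDualN {d : ℕ} (k : ℕ) (r : ℕ → ℕ) (α : Fin (d + 1) → ℕ) (N : Finset (Fin (d + 1))) : Prop :=
  N.card ≤ d ∧ α ∈ dualLayer d k r N.card ∧ ∑ i ∈ N, α i ≤ r N.card

/-- The set `N'(α)`: some admissible choice. -/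
def dualN {d : ℕ} (k : ℕ) (r : ℕ → ℕ) (α : Fin (d + 1) → ℕ) : Finset (Fin (d + 1)) :=
  Classical.epsilon (IsDualN k r α)

/-- `Δ'(α) = {0, …, d} \ N'(α)`. -/
def dualDelta {d : ℕ} (k : ℕ) (r : ℕ → ℕ) (α : Fin (d + 1) → ℕ) : Finset (Fin (d + 1)) :=
  (dualN k r α)ᶜ

/-- `n'(α) = ∑ i ∈ N'(α), α_i`. -/
def dualOrder {d : ℕ} (k : ℕ) (r : ℕ → ℕ) (α : Fin (d + 1) → ℕ) : ℕ :=
  ∑ i ∈ dualN k r α, α i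

/-! ### Nodes -/

/-- The integer `r_{s+1} - n + 1` for `s = card N'(α)`, `n = n'(α)`. For `s = d` there is no
`r_{d+1}`; it is read as `0`, which has no effect: the node below is then a vertex, with
`λ_i = k / k` for the only `i ∈ Δ'(α)`. -/
def nodeShift {d : ℕ} (k : ℕ) (r : ℕ → ℕ) (α : Fin (d + 1) → ℕ) : ℤ :=
  (if (dualN k r α).card < d then (r ((dualN k r α).card + 1) : ℤ) else 0)
    - (dualOrder k r α : ℤ) + 1

/-- The barycentric coordinates of the node of `α`: with `c` the shift above,
`R_i = α_i - c` and `S = k - n'(α) - (d + 1 - card N'(α)) c`, they are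
`λ_i = (R_i + 1) / (S + card Δ'(α))` for `i ∈ Δ'(α)` and `λ_i = 0` otherwise. -/
def nodeCoord {d : ℕ} (k : ℕ) (r : ℕ → ℕ) (α : Fin (d + 1) → ℕ) (i : Fin (d + 1)) : ℝ :=
  if i ∈ dualDelta k r α then
    (((α i : ℤ) - nodeShift k r α + 1 : ℤ) : ℝ) /
      (((k : ℤ) - dualOrder k r α - ((d : ℤ) + 1 - (dualN k r α).card) * nodeShift k r α
        + (dualDelta k r α).card : ℤ) : ℝ)
  else 0

/-- The node of `α` in the simplex with vertices `x_0, …, x_d`. -/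
def node {d : ℕ} (x : Fin (d + 1) → E d) (k : ℕ) (r : ℕ → ℕ) (α : Fin (d + 1) → ℕ) : E d :=
  ∑ i, nodeCoord k r α i • x i

/-! ### Normal vectors and degrees of freedom -/

/-- The component orthogonal to the face spanned by `x_j`, `j ∈ Δ`, of the vector from
the barycenter of this face to `x_i`. -/
def heightVec {d : ℕ} (x : Fin (d + 1) → E d) (Δ : Finset (Fin (d + 1))) (i : Fin (d + 1)) : E d :=
  (vectorSpan ℝ (x '' (Δ : Set (Fin (d + 1)))))ᗮ.starProjection
    (x i - (Δ.card : ℝ)⁻¹ • ∑ j ∈ Δ, x j)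

/-- The outer unit normal vector `m_i` of the face spanned by `x_j`, `j ∈ Δ`, as a face of
the simplex spanned by `x_j`, `j ∈ Δ ∪ {i}` (for `Δ` nonempty, `i ∉ Δ`). -/
def outerNormal {d : ℕ} (x : Fin (d + 1) → E d) (Δ : Finset (Fin (d + 1))) (i : Fin (d + 1)) :
    E d :=
  -((‖heightVec x Δ i‖⁻¹ : ℝ) • heightVec x Δ i)

/-- The list of the vectors `m_i`, `i ∈ N'(α)`, with `m_i` repeated `α_i` times. -/
def directions {d : ℕ} (x : Fin (d + 1) → E d) (k : ℕ) (r : ℕ → ℕ) (α : Fin (d + 1) → ℕ) :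
    List (E d) :=
  (List.finRange (d + 1)).flatMap fun i =>
    if i ∈ dualN k r α then List.replicate (α i) (outerNormal x (dualDelta k r α) i) else []

/-- The degree of freedom `ψ_α` of the simplex `K` with vertices `x_0, …, x_d`: the mixed
directional derivative of order `n'(α)`, with `α_i` derivatives along `m_i` for `i ∈ N'(α)`, at the
node of `α`. The derivatives are those of the restriction of `u` to `K` (one-sided where the node
is on the boundary of `K`). -/
def dof {d : ℕ} (x : Fin (d + 1) → E d) (k : ℕ) (r : ℕ → ℕ) (α : Fin (d + 1) → ℕ)
    (u : E d → ℝ) : ℝ :=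
  iteratedFDerivWithin ℝ (directions x k r α).length u (convexHull ℝ (Set.range x))
    (node x k r α) (directions x k r α).get

/-- The polynomials `p_α` satisfy `∑ α, ψ_α(u) p_α = u` for every polynomial `u` of degree at
most `k`. -/
def Reproduces {d : ℕ} (x : Fin (d + 1) → E d) (k : ℕ) (r : ℕ → ℕ)
    (p : multiIndex d k → polySpace d k) : Prop :=
  ∀ u : polySpace d k, ∑ α : multiIndex d k, dof x k r α (u : E d → ℝ) • p α = u

/-- The local interpolant `∑ α, ψ_α(u) p_α`. -/
def localInterp {d : ℕ} (x : Fin (d + 1) → E d) (k : ℕ) (r : ℕ → ℕ)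
    (p : multiIndex d k → polySpace d k) (u : E d → ℝ) : polySpace d k :=
  ∑ α : multiIndex d k, dof x k r α u • p α

/-! ### Meshes -/

/-- The elements of a mesh: the `d`-dimensional simplices, given by their sets of vertices. -/
def cells {d : ℕ} (T : Geometry.SimplicialComplex ℝ (E d)) : Set (Finset (E d)) :=
  {s | s ∈ T.faces ∧ s.card = d + 1}

/-- A `d`-dimensional simplicial mesh of `T.space`: a simplicial complex in which every face belongs
to a `d`-dimensional simplex, locally finite (in particular, any finite one). -/
structure IsMesh {d : ℕ} (T : Geometry.SimplicialComplex ℝ (E d)) : Prop where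
  subset_cell : ∀ s ∈ T.faces, ∃ t ∈ cells T, s ⊆ t
  locallyFinite : LocallyFinite fun s : cells T => convexHull ℝ ((s : Finset (E d)) : Set (E d))

end CrInterp

end

noncomputable section

namespace CrInterp

open Finset

/-! Write a polynomial of degree at most k as ∑ c_β λ^β in barycentric coordinates. With respect to
these monomials the degrees of freedom are block triangular. At the node of α all λ_i with i ∈ N'(α)
vanish, and for distinct i, j ∈ N'(α) the coordinate λ_j is constant along m_i. Hence ψ_α(λ^β) = 0
unless β ≤ α on N'(α). Lowering α on N'(α) either keeps N' or leads to a larger one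
(`Admissible.dualN_of_le`), a consequence of the doubling condition on r. So if indices are ordered
by decreasing #N' and then by increasing n', the unknowns c_β not yet known to vanish in ψ_α are
those with the same N' and the same components on it. On such a block ψ_α is, up to one nonzero
constant, evaluation of ∏ λ_i^{β_i}, i ∉ N', at the node (`exists_jet_baryMono_eq`). After a common
shift of the exponents this is interpolation at a principal lattice inside a face, which is unique
(`Admissible.eq_zero_of_dualGroup`). The result, `Admissible.coeff_eq_zero`, holds on every lower
closed set A of indices. With A the set of all indices it gives unisolvence, since there are as many
functionals as coefficients.

For the smoothness, let K and K' meet, let N be the set of vertices of K outside K', and number the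
common vertices alike. Take A = {α : ∑_{i ∈ N} α_i ≤ r_1}. For α ∈ A one has N ⊆ N'(α), so the face
Δ'(α) and the node on it are common to K and K'. The normals of K at this face lie in the span of
those of K', and they coincide for i ∉ N. Therefore ψ^K_α is a combination of functionals
ψ^{K'}_{α'}, where α' arises by redistributing the weight on N over N'(α), and this does not change
N' (`Admissible.isDualN_of_move`). So both interpolants take the values ψ^K_α(u) for α ∈ A, and
their difference has c_α = 0 on A. The other monomials have degree more than r_1 in the λ_i, i ∈ N,
so their derivatives up to order r_1 vanish on the common face. -/

/-! ### The dual decomposition -/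

/-- The assumptions on the smoothness vector `(r_1, …, r_d)` and on the degree `k`. -/
def Admissible (d k : ℕ) (r : ℕ → ℕ) : Prop :=
  (∀ i, 1 ≤ i → i < d → 2 * r i ≤ r (i + 1)) ∧ 2 * r d + 1 ≤ k

variable {d k : ℕ} {r : ℕ → ℕ} {α α' : Fin (d + 1) → ℕ} {M N : Finset (Fin (d + 1))}

theorem mem_multiIndex : α ∈ multiIndex d k ↔ ∑ i, α i = k := by
  simp [multiIndex]

theorem Admissible.mono (h : Admissible d k r) {i j : ℕ} (hi : 1 ≤ i) (hij : i ≤ j) (hj : j ≤ d) :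
    r i ≤ r j := by
  induction j, hij using Nat.le_induction with
  | base => exact le_rfl
  | succ j hij ih =>
    have := ih (by omega)
    have := h.1 j (by omega) (by omega)
    omega

/-- Otherwise a subset of X would serve as N_{s+1}, and α would belong to `smallUpTo` at s + 1,
which the layer excludes. -/
theorem lt_sum_of_mem_dualLayer {s : ℕ} (h : α ∈ dualLayer d k r s) (hs : s < d)
    {X : Finset (Fin (d + 1))} (hX : s + 1 ≤ X.card) : r (s + 1) < ∑ i ∈ X, α i := by
  by_contra! hle
  refine h.2 (Set.mem_biUnion (x := s + 1) ⟨by omega, by omega⟩ ⟨h.1.1, fun t ht hts => ?_⟩)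
  rcases Nat.lt_or_ge s t with hst | hst
  · obtain rfl : t = s + 1 := by omega
    obtain ⟨Y, hYX, hY⟩ := exists_subset_card_eq hX
    exact ⟨Y, hY, (sum_le_sum_of_subset hYX).trans hle⟩
  · exact h.1.2 t ht hst

/-- If X is not inside M, then X ∪ M has at least s + 1 elements and weight at most 2 r_s ≤ r_{s+1},
against the maximality of s. For s = d the union is the whole index set, of weight k > 2 r_d.
Uniqueness of N'(α) follows. -/
theorem Admissible.subset_of_sum_le (h : Admissible d k r) (hM : IsDualN k r α M)
    {X : Finset (Fin (d + 1))} (hX : X.card ≤ M.card) (hs : ∑ i ∈ X, α i ≤ r M.card) : X ⊆ M := by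
  by_contra hXM
  have hM0 : 1 ≤ M.card := by
    by_contra! h0
    have : X = ∅ := card_eq_zero.1 (by omega)
    simp [this] at hXM
  have hcard : M.card + 1 ≤ (X ∪ M).card := by
    apply card_lt_card
    refine ⟨subset_union_right, fun hh => hXM (subset_union_left.trans hh)⟩
  have hsum : ∑ i ∈ X ∪ M, α i ≤ 2 * r M.card := by
    have := sum_union_inter (s₁ := X) (s₂ := M) (f := α)
    have := hM.2.2
    omega
  rcases hM.1.lt_or_eq with hlt | heq
  · have := lt_sum_of_mem_dualLayer hM.2.1 hlt hcard
    have := h.1 _ hM0 hlt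
    omega
  · have hu : X ∪ M = univ := by
      rw [← card_eq_iff_eq_univ]
      have := card_le_univ (X ∪ M)
      simp only [Fintype.card_fin] at this ⊢
      omega
    have hk := mem_multiIndex.1 hM.2.1.1.1
    have := h.2
    rw [hu, hk, heq] at hsum
    omega

theorem dualLayer_card_unique {s t : ℕ} (hs : α ∈ dualLayer d k r s) (ht : α ∈ dualLayer d k r t)
    (hsd : s ≤ d) (htd : t ≤ d) : s = t := by
  rcases lt_trichotomy s t with h | h | h
  · exact absurd (Set.mem_biUnion (x := t) (show t ∈ Set.Ioc s d from ⟨h, htd⟩) ht.1) hs.2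
  · exact h
  · exact absurd (Set.mem_biUnion (x := s) (show s ∈ Set.Ioc t d from ⟨h, hsd⟩) hs.1) ht.2

theorem Admissible.isDualN_unique (h : Admissible d k r) (hM : IsDualN k r α M)
    (hN : IsDualN k r α N) : N = M := by
  have hc := dualLayer_card_unique hN.2.1 hM.2.1 hN.1 hM.1
  exact eq_of_subset_of_card_le (h.subset_of_sum_le hM hc.le (hc ▸ hN.2.2)) hc.ge

theorem exists_isDualN {t : ℕ} (ht : t ≤ d)
    (hα' : α ∈ smallUpTo d k r t) : ∃ M, IsDualN k r α M ∧ t ≤ M.card := by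
  classical
  let F := (Finset.range (d + 1)).filter fun m => α ∈ smallUpTo d k r m
  have hF : F.Nonempty := ⟨t, by simp only [F, mem_filter, mem_range]; exact ⟨by omega, hα'⟩⟩
  have hm : F.max' hF < d + 1 ∧ α ∈ smallUpTo d k r (F.max' hF) := by
    simpa only [F, mem_filter, mem_range] using F.max'_mem hF
  have hmt : t ≤ F.max' hF := F.le_max' t (by
    simp only [F, mem_filter, mem_range]; exact ⟨by omega, hα'⟩)
  have hlay : α ∈ dualLayer d k r (F.max' hF) := by
    refine ⟨hm.2, ?_⟩
    simp only [Set.mem_iUnion, not_exists]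
    intro s' hs' hs
    have := F.le_max' s' (by
      simp only [F, mem_filter, mem_range]; exact ⟨by have := hs'.2; omega, hs⟩)
    exact absurd hs'.1 (not_lt.2 this)
  rcases Nat.eq_zero_or_pos (F.max' hF) with h0 | h0
  · refine ⟨∅, ⟨by simp, ?_, by simp⟩, by simp; omega⟩
    rw [h0] at hlay
    simpa using hlay
  · obtain ⟨M, hM, hs⟩ := hm.2.2 _ h0 le_rfl
    exact ⟨M, ⟨by omega, by rwa [hM], by rwa [hM]⟩, by omega⟩

theorem isDualN_dualN (hα : α ∈ multiIndex d k) : IsDualN k r α (dualN k r α) := by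
  obtain ⟨M, hM, -⟩ := exists_isDualN (k := k) (r := r) (α := α) (t := 0) (by omega)
    ⟨hα, fun t h1 h2 => by omega⟩
  exact Classical.epsilon_spec ⟨M, hM⟩

theorem Admissible.dualN_eq (h : Admissible d k r) (hM : IsDualN k r α M) : dualN k r α = M :=
  h.isDualN_unique hM (isDualN_dualN hM.2.1.1.1)

/-- The sets `N_t` can be taken inside `N'(α)`. -/
theorem Admissible.exists_subset (h : Admissible d k r) (hM : IsDualN k r α M) {t : ℕ}
    (ht : 1 ≤ t) (htM : t ≤ M.card) : ∃ X ⊆ M, X.card = t ∧ ∑ i ∈ X, α i ≤ r t := by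
  obtain ⟨X, hX, hs⟩ := hM.2.1.1.2 t ht htM
  exact ⟨X, h.subset_of_sum_le hM (by omega) (hs.trans (h.mono ht htM hM.1)), hX, hs⟩

/-- Lowering the components on `N'(α)` leaves a multi-index in its layer or moves it to a higher
one. -/
theorem Admissible.dualN_of_le (h : Admissible d k r) (hM : IsDualN k r α M)
    (hα' : α' ∈ multiIndex d k) (hle : ∀ i ∈ M, α' i ≤ α i) :
    dualN k r α' = M ∨ M.card < (dualN k r α').card := by
  have hs : α' ∈ smallUpTo d k r M.card := by
    refine ⟨hα', fun t ht htM => ?_⟩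
    obtain ⟨X, hXM, hX, hs⟩ := h.exists_subset hM ht htM
    exact ⟨X, hX, (sum_le_sum fun i hi => hle i (hXM hi)).trans hs⟩
  obtain ⟨M', hM', hc⟩ := exists_isDualN hM.1 hs
  rw [h.dualN_eq hM']
  rcases hc.eq_or_lt with hc | hc
  · left
    exact (eq_of_subset_of_card_le (h.subset_of_sum_le hM' hc.le
      (hc ▸ (sum_le_sum hle).trans hM.2.2)) hc.ge).symm
  · exact Or.inr hc

theorem IsDualN.lt_of_notMem (hM : IsDualN k r α M) (hd : M.card < d) {i : Fin (d + 1)}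
    (hi : i ∉ M) : r (M.card + 1) < α i + ∑ j ∈ M, α j := by
  have := lt_sum_of_mem_dualLayer hM.2.1 hd (X := insert i M) (by rw [card_insert_of_notMem hi])
  rwa [sum_insert hi] at this

/-- A higher layer would provide X with s + 1 elements and weight at most r_{s+1}. If X has one
element outside M, then X is M with this element added, and its weight is too large by `hlt`. If X
has two, each weighs more than r_{s+1} - r_s ≥ r_{s+1} / 2 (more than r_1 if s = 0). -/
theorem Admissible.isDualN_of_lt (h : Admissible d k r) (hα : α ∈ smallUpTo d k r M.card)
    (hd : M.card ≤ d) (hs : ∑ i ∈ M, α i ≤ r M.card)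
    (hlt : M.card < d → ∀ i ∉ M, r (M.card + 1) < α i + ∑ j ∈ M, α j) : IsDualN k r α M := by
  refine ⟨hd, ⟨hα, ?_⟩, hs⟩
  simp only [Set.mem_iUnion, not_exists]
  rintro t ⟨ht, htd⟩ hαt
  have hMd : M.card < d := by omega
  have hlt := hlt hMd
  obtain ⟨X, hX, hXs⟩ := hαt.2 (M.card + 1) (by omega) (by omega)
  have hcard : 1 ≤ (X \ M).card := by
    have := le_card_sdiff M X
    omega
  rcases hcard.eq_or_lt with h1 | h1
  · obtain ⟨i, hi⟩ := card_eq_one.1 h1.symm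
    have hiX : i ∈ X \ M := by simp [hi]
    have hMX : M ⊆ X := by
      have h2 := card_sdiff_add_card_inter X M
      have : X ∩ M = M := eq_of_subset_of_card_le inter_subset_right (by omega)
      exact inter_eq_right.1 this
    have := hlt i (mem_sdiff.1 hiX).2
    have h3 : ∑ j ∈ insert i M, α j ≤ ∑ j ∈ X, α j :=
      sum_le_sum_of_subset (insert_subset (mem_sdiff.1 hiX).1 hMX)
    rw [sum_insert (mem_sdiff.1 hiX).2] at h3
    omega
  · obtain ⟨i, hi, j, hj, hij⟩ := one_lt_card.1 h1
    have hi' := hlt i (mem_sdiff.1 hi).2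
    have hj' := hlt j (mem_sdiff.1 hj).2
    have h3 : ∑ l ∈ {i, j}, α l ≤ ∑ l ∈ X, α l := sum_le_sum_of_subset (by
      intro l hl
      simp only [mem_insert, mem_singleton] at hl
      rcases hl with rfl | rfl
      exacts [(mem_sdiff.1 hi).1, (mem_sdiff.1 hj).1])
    rw [sum_pair hij] at h3
    rcases Nat.eq_zero_or_pos M.card with h0 | h0
    · rw [card_eq_zero.1 h0] at hi' hj' hXs
      simp only [sum_empty, card_empty] at hi' hj' hXs
      omega
    · have := h.1 M.card h0 hMd
      omega

/-- Every subset of N has weight at most r_1 ≤ r_t, so α lies in a layer of index at least #N, and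
N'(α) absorbs all light sets of at most its size. -/
theorem Admissible.subset_dualN (h : Admissible d k r) (hα : α ∈ multiIndex d k) (hN : N.card ≤ d)
    (hs : ∑ i ∈ N, α i ≤ r 1) : N ⊆ dualN k r α := by
  rcases Nat.eq_zero_or_pos N.card with h0 | h0
  · simp [card_eq_zero.1 h0]
  obtain ⟨M, hM, hc⟩ := exists_isDualN (k := k) (r := r) (α := α) hN ⟨hα, fun t ht htN => by
    obtain ⟨X, hX, hXc⟩ := exists_subset_card_eq htN
    exact ⟨X, hXc, ((sum_le_sum_of_subset hX).trans hs).trans (h.mono le_rfl ht (by omega))⟩⟩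
  rw [h.dualN_eq hM]
  exact h.subset_of_sum_le hM hc (hs.trans (h.mono le_rfl (by omega) hM.1))

/-- The sets N_t can form part of a family above N: if Y serves for t + 1 and does not contain X,
then two elements of Y lie outside X. The lighter one weighs at most r_{t+1} / 2, and X weighs at
most r_t ≤ r_{t+1} / 2, so it can be added to X. -/
theorem Admissible.exists_between (h : Admissible d k r) (hM : IsDualN k r α M) (hNM : N ⊆ M)
    (hN : 1 ≤ N.card) (hs : ∑ i ∈ N, α i ≤ r 1) {t : ℕ} (ht : N.card ≤ t) (htM : t ≤ M.card) :
    ∃ X, N ⊆ X ∧ X ⊆ M ∧ X.card = t ∧ ∑ i ∈ X, α i ≤ r t := by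
  induction t, ht using Nat.le_induction with
  | base =>
    exact ⟨N, subset_rfl, hNM, rfl, hs.trans (h.mono le_rfl hN (htM.trans hM.1))⟩
  | succ t ht ih =>
    obtain ⟨X, hNX, hXM, hX, hXs⟩ := ih (by omega)
    obtain ⟨Y, hYM, hY, hYs⟩ := h.exists_subset hM (t := t + 1) (by omega) htM
    have hcard : 1 ≤ (Y \ X).card := by
      have := le_card_sdiff X Y
      omega
    have hdbl := h.1 t (by omega) (by have := hM.1; omega)
    rcases hcard.eq_or_lt with h1 | h1
    · refine ⟨Y, hNX.trans ?_, hYM, hY, hYs⟩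
      have h2 := card_sdiff_add_card_inter Y X
      exact inter_eq_right.1 (eq_of_subset_of_card_le inter_subset_right (by omega))
    · obtain ⟨i, hi, j, hj, hij⟩ := one_lt_card.1 h1
      rw [mem_sdiff] at hi hj
      have h3 : ∑ l ∈ {i, j}, α l ≤ ∑ l ∈ Y, α l := sum_le_sum_of_subset (by
        intro l hl
        simp only [mem_insert, mem_singleton] at hl
        rcases hl with rfl | rfl
        exacts [hi.1, hj.1])
      rw [sum_pair hij] at h3
      have key : ∀ l ∈ Y, l ∉ X → 2 * α l ≤ r (t + 1) →
          ∃ X, N ⊆ X ∧ X ⊆ M ∧ X.card = t + 1 ∧ ∑ i ∈ X, α i ≤ r (t + 1) := by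
        intro l hlY hlX hl
        refine ⟨insert l X, hNX.trans (subset_insert _ _), insert_subset (hYM hlY) hXM,
          by rw [card_insert_of_notMem hlX, hX], ?_⟩
        rw [sum_insert hlX]
        omega
      rcases le_total (α i) (α j) with hle | hle
      · exact key i hi.1 hi.2 (by omega)
      · exact key j hj.1 hj.2 (by omega)

/-- Moving weight from `N` to `N'(α) \ N` does not change `N'(α)` if the weight on `N` is at most
`r_1`. -/
theorem Admissible.isDualN_of_move (h : Admissible d k r) (hM : IsDualN k r α M) (hNM : N ⊆ M)
    (hs : ∑ i ∈ N, α i ≤ r 1) (hα' : α' ∈ multiIndex d k) (hoff : ∀ i ∉ M, α' i = α i)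
    (hge : ∀ i ∈ M, i ∉ N → α i ≤ α' i) : IsDualN k r α' M := by
  have hsum : ∑ i ∈ M, α' i = ∑ i ∈ M, α i := by
    have h1 := mem_multiIndex.1 hα'
    have h2 := mem_multiIndex.1 hM.2.1.1.1
    rw [← sum_add_sum_compl M] at h1 h2
    have : ∑ i ∈ Mᶜ, α' i = ∑ i ∈ Mᶜ, α i :=
      sum_congr rfl fun i hi => hoff i (by simpa using hi)
    omega
  -- The total weight on M is unchanged and no component in M \ N decreases, so every set between N
  -- and M can only lose weight.
  have hX : ∀ X, N ⊆ X → X ⊆ M → ∑ i ∈ X, α' i ≤ ∑ i ∈ X, α i := by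
    intro X hNX hXM
    have h1 := sum_sdiff hXM (f := α')
    have h2 := sum_sdiff hXM (f := α)
    have h3 : ∑ i ∈ M \ X, α i ≤ ∑ i ∈ M \ X, α' i := sum_le_sum fun i hi =>
      hge i (mem_sdiff.1 hi).1 fun hN => (mem_sdiff.1 hi).2 (hNX hN)
    omega
  refine h.isDualN_of_lt ⟨hα', fun t ht htM => ?_⟩ hM.1 (hsum ▸ hM.2.2) fun hd i hi => ?_
  · rcases Nat.eq_zero_or_pos N.card with h0 | h0
    -- `exists_between` needs N nonempty; for N = ∅ nothing is moved.
    · have hN : N = ∅ := card_eq_zero.1 h0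
      have hall : ∀ i ∈ M, α' i = α i := by
        have h4 := (sum_eq_sum_iff_of_le fun i hi => hge i hi (by simp [hN])).1 hsum.symm
        exact fun i hi => (h4 i hi).symm
      obtain ⟨X, hXM, hXc, hXs⟩ := h.exists_subset hM ht htM
      exact ⟨X, hXc, (hX X (by simp [hN]) hXM).trans hXs⟩
    rcases le_total t N.card with htN | htN
    · obtain ⟨X, hXN, hXc⟩ := exists_subset_card_eq htN
      exact ⟨X, hXc, ((sum_le_sum_of_subset hXN).trans ((hX N subset_rfl hNM).trans hs)).trans
        (h.mono le_rfl ht (htM.trans hM.1))⟩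
    · obtain ⟨X, hNX, hXM, hXc, hXs⟩ := h.exists_between hM hNM h0 hs htN htM
      exact ⟨X, hXc, (hX X hNX hXM).trans hXs⟩
  · rw [hsum, hoff i hi]
    exact hM.lt_of_notMem hd hi

/-! ### The nodes -/

theorem card_compl_pos (hM : IsDualN k r α M) : 0 < Mᶜ.card := by
  have := card_compl M
  have := hM.1
  simp only [Fintype.card_fin] at *
  omega

/-- The numerators of the barycentric coordinates of a node are positive. -/
theorem Admissible.one_le_sub_nodeShift (h : Admissible d k r) (hα : α ∈ multiIndex d k)
    {i : Fin (d + 1)} (hi : i ∉ dualN k r α) : 1 ≤ (α i : ℤ) - nodeShift k r α + 1 := by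
  have hM := isDualN_dualN (r := r) hα
  unfold nodeShift dualOrder
  split_ifs with hd
  · have := hM.lt_of_notMem hd hi
    omega
  -- Here α_i = k - n' and the shift is 1 - n', so the numerator is k.
  · have hd : (dualN k r α).card = d := le_antisymm hM.1 (not_lt.1 hd)
    have hu : insert i (dualN k r α) = univ := by
      rw [← card_eq_iff_eq_univ, card_insert_of_notMem hi, hd, Fintype.card_fin]
    have hsum := mem_multiIndex.1 hα
    rw [← hu, sum_insert hi] at hsum
    have := h.2
    omega

theorem sum_sub_nodeShift (hα : α ∈ multiIndex d k) :
    ∑ i ∈ dualDelta k r α, ((α i : ℤ) - nodeShift k r α + 1) =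
      (k : ℤ) - dualOrder k r α - ((d : ℤ) + 1 - (dualN k r α).card) * nodeShift k r α
        + (dualDelta k r α).card := by
  have hc : ((dualDelta k r α).card : ℤ) = (d : ℤ) + 1 - (dualN k r α).card := by
    have h1 := card_compl (dualN k r α)
    have h2 := card_le_univ (dualN k r α)
    simp only [Fintype.card_fin] at h1 h2
    unfold dualDelta
    omega
  have hs : (∑ i ∈ dualDelta k r α, (α i : ℤ)) = (k : ℤ) - dualOrder k r α := by
    have h1 := sum_add_sum_compl (dualN k r α) α
    rw [mem_multiIndex.1 hα] at h1
    unfold dualDelta dualOrder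
    zify at h1
    push_cast
    linarith
  rw [sum_add_distrib, sum_sub_distrib, hs]
  simp only [sum_const, nsmul_eq_mul, mul_one]
  rw [hc]

theorem Admissible.nodeDenom_pos (h : Admissible d k r) (hα : α ∈ multiIndex d k) :
    0 < ∑ i ∈ dualDelta k r α, ((α i : ℤ) - nodeShift k r α + 1) := by
  apply sum_pos
  · intro i hi
    have := h.one_le_sub_nodeShift hα (i := i) (by simpa [dualDelta] using hi)
    omega
  · exact card_pos.1 (card_compl_pos (isDualN_dualN hα))

theorem nodeCoord_eq (hα : α ∈ multiIndex d k) (i : Fin (d + 1)) :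
    nodeCoord k r α i = if i ∈ dualDelta k r α then
      (((α i : ℤ) - nodeShift k r α + 1 : ℤ) : ℝ) /
        ((∑ i ∈ dualDelta k r α, ((α i : ℤ) - nodeShift k r α + 1) : ℤ) : ℝ) else 0 := by
  rw [sum_sub_nodeShift hα, nodeCoord]

theorem Admissible.nodeCoord_nonneg (h : Admissible d k r) (hα : α ∈ multiIndex d k)
    (i : Fin (d + 1)) : 0 ≤ nodeCoord k r α i := by
  rw [nodeCoord_eq hα]
  split_ifs with hi
  · have h1 := h.one_le_sub_nodeShift hα (i := i) (by simpa [dualDelta] using hi)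
    have h2 := h.nodeDenom_pos hα
    exact div_nonneg (by exact_mod_cast (by omega)) (by exact_mod_cast h2.le)
  · exact le_rfl

theorem nodeCoord_of_mem {i : Fin (d + 1)} (hi : i ∈ dualN k r α) : nodeCoord k r α i = 0 := by
  simp [nodeCoord, dualDelta, hi]

theorem Admissible.sum_nodeCoord (h : Admissible d k r) (hα : α ∈ multiIndex d k) :
    ∑ i, nodeCoord k r α i = 1 := by
  simp_rw [nodeCoord_eq hα]
  rw [sum_ite_mem, univ_inter, ← sum_div, ← Int.cast_sum]
  exact div_self (by exact_mod_cast (h.nodeDenom_pos hα).ne')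

/-- The node depends on `α` only through `N'(α)`, `n'(α)` and the components on `Δ'(α)`. -/
theorem nodeCoord_congr (hN : dualN k r α' = dualN k r α)
    (hoff : ∀ i ∉ dualN k r α, α' i = α i)
    (hsum : ∑ i ∈ dualN k r α, α' i = ∑ i ∈ dualN k r α, α i) :
    nodeCoord k r α' = nodeCoord k r α := by
  ext i
  have ho : dualOrder k r α' = dualOrder k r α := by simp [dualOrder, hN, hsum]
  have hc : nodeShift k r α' = nodeShift k r α := by simp [nodeShift, hN, ho]
  unfold nodeCoord
  rw [hc, ho]
  simp only [dualDelta, hN, mem_compl]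
  split_ifs with hi
  · rfl
  · rw [hoff i hi]

/-! ### Iterated directional derivatives -/

section Jet

variable {V : Type*} [NormedAddCommGroup V] [NormedSpace ℝ V] {s t : Set V} {f g : V → ℝ}
  {n : ℕ} {y : V} {l l' : List V} {v w : V}

/-- The iterated directional derivative of `f` on `s` along the vectors of a list. -/
def jet (s : Set V) (f : V → ℝ) (l : List V) (y : V) : ℝ :=
  iteratedFDerivWithin ℝ l.length f s y l.get

@[simp]
theorem jet_nil : jet s f [] y = f y := by
  simp [jet]

theorem jet_cons (hs : UniqueDiffOn ℝ s) (hf : ContDiffOn ℝ n f s) (hl : l.length < n)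
    (hy : y ∈ s) : jet s f (v :: l) y = fderivWithin ℝ (jet s f l) s y v := by
  have hd : DifferentiableWithinAt ℝ (iteratedFDerivWithin ℝ l.length f s) s y :=
    hf.differentiableOn_iteratedFDerivWithin (by exact_mod_cast hl) hs y hy
  have h := ((ContinuousMultilinearMap.apply ℝ (fun _ : Fin l.length => V) ℝ
    l.get).hasFDerivAt.comp_hasFDerivWithinAt y hd.hasFDerivWithinAt).fderivWithin (hs y hy)
  have h2 : fderivWithin ℝ (jet s f l) s y = _ := h
  rw [h2]
  rfl

theorem jet_congr (h : Set.EqOn f g s) (hy : y ∈ s) : jet s f l y = jet s g l y := by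
  unfold jet
  rw [iteratedFDerivWithin_congr h hy]

theorem contDiffOn_jet {m : ℕ} (hs : UniqueDiffOn ℝ s) (hf : ContDiffOn ℝ n f s)
    (hm : m + l.length ≤ n) : ContDiffOn ℝ m (jet s f l) s := by
  intro y hy
  have h := (hf y hy).iteratedFDerivWithin_right (m := m) (i := l.length) hs
    (by exact_mod_cast hm) hy
  exact (ContinuousMultilinearMap.apply ℝ (fun _ : Fin l.length => V) ℝ
    l.get).contDiff.comp_contDiffWithinAt h

/-- Iterated directional derivatives do not depend on the order of the directions. -/
theorem jet_perm (hc : Convex ℝ s) (hi : (interior s).Nonempty) (hl : l.Perm l')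
    (hf : ContDiffOn ℝ n f s) (hn : l.length ≤ n) (hy : y ∈ s) : jet s f l y = jet s f l' y := by
  have hs := uniqueDiffOn_convex hc hi
  induction hl generalizing y with
  | nil => rfl
  | cons v hl ih =>
    simp only [List.length_cons] at hn
    rw [jet_cons hs hf (by omega) hy, jet_cons hs hf (by rw [← hl.length_eq]; omega) hy,
      fderivWithin_congr (fun z hz => ih (by omega) hz) (ih (by omega) hy)]
  | swap a b l =>
    simp only [List.length_cons] at hn
    have hj : ContDiffOn ℝ 2 (jet s f l) s := contDiffOn_jet (m := 2) hs hf (by omega)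
    -- Symmetry of the second derivative within s requires y to be a limit of interior points, which
    -- holds throughout a convex set with nonempty interior.
    have hsym : IsSymmSndFDerivWithinAt ℝ (jet s f l) s y :=
      (hj y hy).isSymmSndFDerivWithinAt (by simp) hs
        (by rw [hc.closure_interior_eq_closure_of_nonempty_interior hi]; exact subset_closure hy) hy
    have key : ∀ a b : V, jet s f (a :: b :: l) y =
        fderivWithin ℝ (fderivWithin ℝ (jet s f l) s) s y a b := by
      intro a b
      rw [jet_cons hs hf (by simp; omega) hy, fderivWithin_congr
        (fun z hz => jet_cons hs hf (by omega) hz) (jet_cons hs hf (by omega) hy)]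
      have hd : DifferentiableWithinAt ℝ (fderivWithin ℝ (jet s f l) s) s y :=
        ((hj y hy).fderivWithin_right (m := 1) hs (by norm_num) hy).differentiableWithinAt
          (by norm_num)
      have h := ((ContinuousLinearMap.apply ℝ ℝ b).hasFDerivAt.comp_hasFDerivWithinAt y
        hd.hasFDerivWithinAt).fderivWithin (hs y hy)
      have h2 : fderivWithin ℝ (fun z => fderivWithin ℝ (jet s f l) s z b) s y = _ := h
      rw [h2]
      rfl
    rw [key, key, hsym.eq]
  | trans h1 h2 ih1 ih2 =>
    rw [ih1 hn hy, ih2 (by rw [← h1.length_eq]; exact hn) hy]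

/-- The head of the list is the outermost derivative, so the last vector is the first one applied to
f. -/
theorem jet_append_singleton (hs : UniqueDiffOn ℝ s) (hf : ContDiffOn ℝ n f s)
    (hn : l.length < n) (hy : y ∈ s) :
    jet s f (l ++ [v]) y = jet s (fun z => fderivWithin ℝ f s z v) l y := by
  obtain ⟨n, rfl⟩ : ∃ m, n = m + 1 := ⟨n - 1, by omega⟩
  have hf' : ContDiffOn ℝ n (fun z => fderivWithin ℝ f s z v) s := fun z hz =>
    ((hf z hz).fderivWithin_right (m := n) hs (by norm_cast) hz).clm_apply contDiffWithinAt_const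
  induction l generalizing y with
  | nil =>
    rw [List.nil_append, jet_cons hs hf (by simp) hy, jet_nil]
    congr 2
  | cons w l ih =>
    simp only [List.length_cons] at hn
    rw [List.cons_append, jet_cons hs hf (by simp; omega) hy, jet_cons hs hf' (by omega) hy,
      fderivWithin_congr (fun z hz => ih hz (by omega)) (ih hy (by omega))]

theorem jet_cons' (hc : Convex ℝ s) (hi : (interior s).Nonempty) (hf : ContDiffOn ℝ n f s)
    (hn : l.length < n) (hy : y ∈ s) :
    jet s f (v :: l) y = jet s (fun z => fderivWithin ℝ f s z v) l y := by
  rw [← jet_append_singleton (uniqueDiffOn_convex hc hi) hf hn hy]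
  exact jet_perm hc hi (List.perm_append_singleton v l).symm hf hn hy

theorem jet_sum {ι : Type*} (I : Finset ι) (c : ι → ℝ) {F : ι → V → ℝ} (hs : UniqueDiffOn ℝ s)
    (hF : ∀ i ∈ I, ContDiffOn ℝ n (F i) s) (hn : l.length ≤ n) (hy : y ∈ s) :
    jet s (fun z => ∑ i ∈ I, c i * F i z) l y = ∑ i ∈ I, c i * jet s (F i) l y := by
  have hsum : ContDiffOn ℝ n (fun z => ∑ i ∈ I, c i * F i z) s :=
    ContDiffOn.sum fun i hi => contDiffOn_const.mul (hF i hi)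
  induction l generalizing y with
  | nil => simp
  | cons v l ih =>
    simp only [List.length_cons] at hn
    have hd : ∀ i ∈ I, HasFDerivWithinAt (fun z => c i * jet s (F i) l z)
        (c i • fderivWithin ℝ (jet s (F i) l) s y) s y := fun i hi =>
      (((contDiffOn_jet (m := 1) hs (hF i hi) (by omega)).differentiableOn (by norm_num)
        y hy).hasFDerivWithinAt).const_mul (c i)
    rw [jet_cons hs hsum (by omega) hy,
      fderivWithin_congr (fun z hz => ih (by omega) hz) (ih (by omega) hy),
      (HasFDerivWithinAt.fun_sum hd).fderivWithin (hs y hy), _root_.sum_apply]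
    refine sum_congr rfl fun i hi => ?_
    rw [jet_cons hs (hF i hi) (by omega) hy]
    simp

theorem jet_sub (hs : UniqueDiffOn ℝ s) (hf : ContDiffOn ℝ n f s) (hg : ContDiffOn ℝ n g s)
    (hn : l.length ≤ n) (hy : y ∈ s) :
    jet s (fun z => f z - g z) l y = jet s f l y - jet s g l y := by
  have h := jet_sum (s := s) (l := l) (y := y) (univ : Finset Bool) (fun b => if b then 1 else -1)
    (F := fun b => if b then f else g) (n := n) hs (by simp [hf, hg]) hn hy
  simp only [Fintype.sum_bool, if_true, Bool.false_eq_true, if_false, one_mul, neg_mul,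
    ← sub_eq_add_neg] at h
  exact h

theorem jet_cons_linear (hs : UniqueDiffOn ℝ s) (hf : ContDiffOn ℝ n f s) (hn : l.length < n)
    (hy : y ∈ s) : ∃ L : V →ₗ[ℝ] ℝ, ∀ v, jet s f (v :: l) y = L v :=
  ⟨fderivWithin ℝ (jet s f l) s y, fun _ => jet_cons hs hf hn hy⟩

theorem jet_subset (hst : s ⊆ t) (hs : UniqueDiffOn ℝ s) (ht : UniqueDiffOn ℝ t)
    (hf : ContDiffOn ℝ n f t) (hn : l.length ≤ n) (hy : y ∈ s) : jet s f l y = jet t f l y := by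
  unfold jet
  rw [iteratedFDerivWithin_subset hst hs ht (hf.of_le (by exact_mod_cast hn)) hy]

/-- If the derivatives along all `js.map m` vanish, where `js` extends `js₀`, then so do those
obtained by replacing the additional vectors by vectors in the span of `m`. -/
theorem jet_sub_eq_zero_of_span {ι : Type*} (m : ι → V) (J : Set ι) (hc : Convex ℝ s)
    (hi : (interior s).Nonempty) (hf : ContDiffOn ℝ n f s) (hg : ContDiffOn ℝ n g s) (hy : y ∈ s)
    (l : List V) (hl : ∀ v ∈ l, v ∈ Submodule.span ℝ (m '' J)) (js₀ : List ι)
    (hn : l.length + js₀.length ≤ n)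
    (h : ∀ js : List ι, (∀ j ∈ js, j ∈ J) → js.length = l.length →
      jet s f ((js ++ js₀).map m) y = jet s g ((js ++ js₀).map m) y) :
    jet s f (l ++ js₀.map m) y = jet s g (l ++ js₀.map m) y := by
  have hs := uniqueDiffOn_convex hc hi
  induction l generalizing js₀ with
  | nil => simpa using h []
  | cons v l ih =>
    simp only [List.length_cons] at hn
    obtain ⟨L, hL⟩ := jet_cons_linear (l := l ++ js₀.map m) hs hf (by simp; omega) hy
    obtain ⟨L', hL'⟩ := jet_cons_linear (l := l ++ js₀.map m) hs hg (by simp; omega) hy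
    rw [List.cons_append, hL, hL']
    have hv := hl v (by simp)
    -- By linearity in the head it suffices to take v = m j. This vector then joins the fixed part
    -- `js₀`, and the induction replaces the rest.
    refine LinearMap.eqOn_span (f := L) (g := L') ?_ hv
    rintro _ ⟨j, hj, rfl⟩
    have hp : (m j :: (l ++ js₀.map m)).Perm (l ++ (j :: js₀).map m) := by
      rw [List.map_cons]
      exact List.perm_middle.symm
    rw [← hL, ← hL', jet_perm hc hi hp hf (by simp; omega) hy,
      jet_perm hc hi hp hg (by simp; omega) hy]
    refine ih (fun w hw => hl w (by simp [hw])) (j :: js₀) (by simp; omega) fun js hjs hlen => ?_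
    have hp' : ((js ++ j :: js₀).map m).Perm (((j :: js) ++ js₀).map m) :=
      (List.perm_middle).map m
    rw [jet_perm hc hi hp' hf (by simp; omega) hy, jet_perm hc hi hp' hg (by simp; omega) hy]
    exact h (j :: js) (by simpa using ⟨hj, hjs⟩) (by simp [hlen])

end Jet

/-! ### Monomials in barycentric coordinates -/

section Monomial

variable {d k : ℕ} (b : AffineBasis (Fin (d + 1)) ℝ (E d)) {s : Set (E d)}
  {α : Fin (d + 1) → ℕ} {M N : Finset (Fin (d + 1))} {y : E d}

/-- The linear part of a barycentric coordinate. -/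
def coordLin (i : Fin (d + 1)) : E d →ₗ[ℝ] ℝ := (b.coord i).linear

theorem hasFDerivAt_coord (i : Fin (d + 1)) (y : E d) :
    HasFDerivAt (b.coord i) (LinearMap.toContinuousLinearMap (coordLin b i)) y := by
  have h : (b.coord i : E d → ℝ) =
      fun z => LinearMap.toContinuousLinearMap (coordLin b i) z + b.coord i 0 := by
    ext z
    exact congrFun (AffineMap.decomp (b.coord i)) z
  rw [h]
  exact (ContinuousLinearMap.hasFDerivAt _).add_const _

theorem contDiff_coord (i : Fin (d + 1)) (n : WithTop ℕ∞) : ContDiff ℝ n (b.coord i) := by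
  have h : (b.coord i : E d → ℝ) =
      fun z => LinearMap.toContinuousLinearMap (coordLin b i) z + b.coord i 0 := by
    ext z
    exact congrFun (AffineMap.decomp (b.coord i)) z
  rw [h]
  exact (ContinuousLinearMap.contDiff _).add contDiff_const

/-- The monomial `λ^α` in barycentric coordinates. -/
def baryMono (α : Fin (d + 1) → ℕ) (y : E d) : ℝ := ∏ i, b.coord i y ^ α i

theorem contDiff_baryMono (α : Fin (d + 1) → ℕ) (n : WithTop ℕ∞) :
    ContDiff ℝ n (baryMono b α) :=
  contDiff_prod fun i _ => (contDiff_coord b i n).pow (α i)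

/-- Truncation in α - e_t is harmless: it occurs only for α t = 0, where the coefficient vanishes.
-/
theorem hasFDerivAt_baryMono (α : Fin (d + 1) → ℕ) (y : E d) :
    HasFDerivAt (baryMono b α) (∑ t, ((α t : ℝ) * baryMono b (α - Pi.single t 1) y) •
      LinearMap.toContinuousLinearMap (coordLin b t)) y := by
  have h := HasFDerivAt.finsetProd (u := univ) (g := fun i z => b.coord i z ^ α i)
    (g' := fun i => ((α i : ℝ) * b.coord i y ^ (α i - 1)) •
      LinearMap.toContinuousLinearMap (coordLin b i)) (x := y) fun i _ => by
        simpa [nsmul_eq_mul, mul_comm] using (hasFDerivAt_coord b i y).pow (α i)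
  convert! h using 1
  refine sum_congr rfl fun t _ => ?_
  rw [smul_smul]
  congr 1
  rw [baryMono, ← mul_prod_erase univ _ (mem_univ t)]
  have : ∏ i ∈ univ.erase t, b.coord i y ^ (α - Pi.single t 1 : Fin (d + 1) → ℕ) i =
      ∏ i ∈ univ.erase t, b.coord i y ^ α i :=
    prod_congr rfl fun i hi => by simp [(mem_erase.1 hi).1]
  rw [this]
  simp
  ring

theorem jet_baryMono_cons (hc : Convex ℝ s) (hi : (interior s).Nonempty) (hy : y ∈ s) (v : E d)
    (l : List (E d)) : jet s (baryMono b α) (v :: l) y =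
      ∑ t, (coordLin b t v * α t) * jet s (baryMono b (α - Pi.single t 1)) l y := by
  have hs := uniqueDiffOn_convex hc hi
  rw [jet_cons' hc hi (n := l.length + 1) (contDiff_baryMono b α _).contDiffOn (by omega) hy,
    ← jet_sum univ _ hs (fun i _ => (contDiff_baryMono b _ _).contDiffOn) le_rfl hy]
  refine jet_congr (fun z hz => ?_) hy
  rw [(hasFDerivAt_baryMono b α z).hasFDerivWithinAt.fderivWithin (hs z hz), _root_.sum_apply]
  refine sum_congr rfl fun t _ => ?_
  simp
  ring

/-- Each derivative lowers the weight on N by at most one, so every resulting term keeps a factor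
λ_i with i ∈ N. -/
theorem jet_baryMono_eq_zero_of_length_lt (hc : Convex ℝ s) (hi : (interior s).Nonempty)
    (hy : y ∈ s) (hN : ∀ i ∈ N, b.coord i y = 0) (l : List (E d))
    (hl : l.length < ∑ i ∈ N, α i) : jet s (baryMono b α) l y = 0 := by
  induction l generalizing α with
  | nil =>
    obtain ⟨i, hi, h0⟩ := exists_ne_zero_of_sum_ne_zero (s := N) (f := α)
      (by intro h; rw [h] at hl; simp at hl)
    rw [jet_nil, baryMono]
    exact prod_eq_zero (mem_univ i) (by rw [hN i hi, zero_pow h0])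
  | cons v l ih =>
    rw [jet_baryMono_cons b hc hi hy]
    refine sum_eq_zero fun t _ => ?_
    rw [ih, mul_zero]
    have h1 : ∑ i ∈ N, α i ≤ ∑ i ∈ N, (α - Pi.single t 1 : Fin (d + 1) → ℕ) i +
        ∑ i ∈ N, (Pi.single t 1 : Fin (d + 1) → ℕ) i := by
      rw [← sum_add_distrib]
      exact sum_le_sum fun i _ => by simp only [Pi.sub_apply]; omega
    have h2 : ∑ i ∈ N, (Pi.single t 1 : Fin (d + 1) → ℕ) i ≤ 1 := by
      simp only [Pi.single_apply, sum_ite_eq']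
      split_ifs <;> simp
    simp only [List.length_cons] at hl
    omega

/-! ### Derivatives of monomials along directions dual to the barycentric coordinates -/

section Normal

variable {m : Fin (d + 1) → E d}

/-- Among the directions m_j, j ∈ M, only m_i lowers the exponent of λ_i, so a factor λ_i survives.
-/
theorem jet_baryMono_eq_zero_of_count_lt (hc : Convex ℝ s) (hi : (interior s).Nonempty)
    (hy : y ∈ s) (hM : ∀ i ∈ M, b.coord i y = 0)
    (hm : ∀ i ∈ M, ∀ j ∈ M, j ≠ i → coordLin b j (m i) = 0) (js : List (Fin (d + 1)))
    (hjs : ∀ j ∈ js, j ∈ M) {i : Fin (d + 1)} (hiM : i ∈ M) (hlt : js.count i < α i) :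
    jet s (baryMono b α) (js.map m) y = 0 := by
  induction js generalizing α with
  | nil =>
    rw [List.map_nil, jet_nil, baryMono]
    exact prod_eq_zero (mem_univ i) (by rw [hM i hiM, zero_pow (by simpa using hlt.ne')])
  | cons j js ih =>
    rw [List.map_cons, jet_baryMono_cons b hc hi hy]
    refine sum_eq_zero fun t _ => ?_
    rw [List.count_cons] at hlt
    have hjs' : ∀ j ∈ js, j ∈ M := fun j' hj' => hjs j' (List.mem_cons_of_mem _ hj')
    by_cases hti : t = i
    · subst hti
      by_cases htj : t = j
      · subst htj
        rw [ih hjs' (by simp at hlt ⊢; omega), mul_zero]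
      · rw [hm j (hjs j (by simp)) t hiM htj]
        simp
    · rw [ih hjs' (by simp only [Pi.sub_apply, Pi.single_apply, if_neg (Ne.symm hti)]; omega),
        mul_zero]

/-- C is the product over i ∈ M of n_i! times the n_i-th power of the derivative of λ_i along m_i,
with n_i the multiplicity of i in `js`. Since it is chosen before y and α, it can be divided out of
a whole block of equations. -/
theorem exists_jet_baryMono_eq (hm : ∀ i ∈ M, ∀ j ∈ M, j ≠ i → coordLin b j (m i) = 0)
    (hm0 : ∀ i ∈ M, coordLin b i (m i) ≠ 0) (js : List (Fin (d + 1))) (hjs : ∀ j ∈ js, j ∈ M) :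
    ∃ C : ℝ, C ≠ 0 ∧ ∀ s : Set (E d), Convex ℝ s → (interior s).Nonempty → ∀ y ∈ s,
      (∀ i ∈ M, b.coord i y = 0) → ∀ α : Fin (d + 1) → ℕ, (∀ i ∈ M, α i = js.count i) →
      jet s (baryMono b α) (js.map m) y = C * ∏ i ∈ Mᶜ, b.coord i y ^ α i := by
  induction js with
  | nil =>
    refine ⟨1, one_ne_zero, fun s hc hi y hy hM α hα => ?_⟩
    rw [List.map_nil, jet_nil, baryMono, ← prod_mul_prod_compl M]
    congr 1
    exact prod_eq_one fun i hi => by rw [hα i hi]; simp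
  | cons j js ih =>
    have hjs' : ∀ j ∈ js, j ∈ M := fun j' hj' => hjs j' (List.mem_cons_of_mem _ hj')
    have hjM : j ∈ M := hjs j (by simp)
    obtain ⟨C, hC, h⟩ := ih hjs'
    refine ⟨coordLin b j (m j) * (js.count j + 1 : ℕ) * C,
      mul_ne_zero (mul_ne_zero (hm0 j hjM) (by positivity)) hC, fun s hc hi y hy hM α hα => ?_⟩
    have hαj : α j = js.count j + 1 := by rw [hα j hjM]; simp
    rw [List.map_cons, jet_baryMono_cons b hc hi hy, sum_eq_single j]
    · rw [h s hc hi y hy hM, hαj, mul_assoc _ C]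
      · congr 2
        refine prod_congr rfl fun i hi' => ?_
        have : i ≠ j := fun hij => (mem_compl.1 hi') (hij ▸ hjM)
        simp [this]
      · intro i hiM
        have := hα i hiM
        rw [List.count_cons] at this
        by_cases hij : i = j
        · subst hij; simp at this ⊢; omega
        · have hji : ¬ j = i := fun h => hij h.symm
          simp [hij, hji] at this ⊢; omega
    · intro t _ htj
      by_cases htM : t ∈ M
      · rw [hm j hjM t htM htj]
        simp
      -- Differentiating a factor outside M leaves the exponent of λ_j one above the number of
      -- remaining derivatives along m_j.
      · rw [jet_baryMono_eq_zero_of_count_lt b hc hi hy hM hm js hjs' hjM, mul_zero]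
        have hjt : j ≠ t := fun h => htM (h ▸ hjM)
        simp [hjt]
        omega
    · simp

end Normal

/-! ### Polynomials as combinations of barycentric monomials -/

/-- The combination `∑ α, c_α λ^α`. -/
def baryPoly (k : ℕ) (c : (Fin (d + 1) → ℕ) → ℝ) (y : E d) : ℝ :=
  ∑ α ∈ multiIndex d k, c α * baryMono b α y

theorem contDiff_baryPoly (c : (Fin (d + 1) → ℕ) → ℝ) (n : WithTop ℕ∞) :
    ContDiff ℝ n (baryPoly b k c) :=
  ContDiff.sum fun α _ => contDiff_const.mul (contDiff_baryMono b α n)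

theorem jet_baryPoly (hc : Convex ℝ s) (hi : (interior s).Nonempty) (hy : y ∈ s)
    (c : (Fin (d + 1) → ℕ) → ℝ) (l : List (E d)) : jet s (baryPoly b k c) l y =
      ∑ α ∈ multiIndex d k, c α * jet s (baryMono b α) l y :=
  jet_sum _ _ (uniqueDiffOn_convex hc hi)
    (fun α _ => (contDiff_baryMono b α l.length).contDiffOn) le_rfl hy

theorem exists_polyFun_eq_coord (i : Fin (d + 1)) :
    ∃ q : MvPolynomial (Fin d) ℝ, q.totalDegree ≤ 1 ∧ polyFun d q = b.coord i := by
  refine ⟨∑ j, MvPolynomial.C (coordLin b i (EuclideanSpace.single j 1)) * MvPolynomial.X j +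
    MvPolynomial.C (b.coord i 0), ?_, ?_⟩
  · refine (MvPolynomial.totalDegree_add _ _).trans (max_le ?_ (by simp))
    refine (MvPolynomial.totalDegree_finsetSum _ _).trans (Finset.sup_le fun j _ => ?_)
    refine (MvPolynomial.totalDegree_mul _ _).trans ?_
    simp
  · ext y
    have h1 : b.coord i y = coordLin b i y + b.coord i 0 :=
      congrFun (AffineMap.decomp (b.coord i)) y
    have h2 : y = ∑ j, y j • EuclideanSpace.single j (1 : ℝ) := by
      ext l
      simp [Pi.single_apply]
    rw [h1]
    conv_rhs => rw [h2]
    simp [polyFun, map_sum, mul_comm]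

theorem baryMono_mem_polySpace (hα : α ∈ multiIndex d k) : baryMono b α ∈ polySpace d k := by
  choose q hq hqf using exists_polyFun_eq_coord b
  refine ⟨∏ i, q i ^ α i, ?_, ?_⟩
  · simp only [SetLike.mem_coe]
    rw [MvPolynomial.mem_restrictTotalDegree]
    refine (MvPolynomial.totalDegree_finsetProd _ _).trans ?_
    rw [← mem_multiIndex.1 hα]
    refine sum_le_sum fun i _ => (MvPolynomial.totalDegree_pow _ _).trans ?_
    exact (Nat.mul_le_mul_left _ (hq i)).trans_eq (mul_one _)
  · ext y
    have : ∀ i, MvPolynomial.eval (fun j => y j) (q i) = b.coord i y := fun i =>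
      congrFun (hqf i) y
    simp [polyFun, baryMono, this]

/-- Substitute y_j = ∑ λ_i (b_i)_j and make each term homogeneous of degree k by a power of ∑ λ_i =
1. -/
theorem exists_baryPoly_eq {p : E d → ℝ} (hp : p ∈ polySpace d k) :
    ∃ c, p = baryPoly b k c := by
  obtain ⟨q, hq, rfl⟩ := hp
  rw [SetLike.mem_coe, MvPolynomial.mem_restrictTotalDegree] at hq
  let X : Fin d → MvPolynomial (Fin (d + 1)) ℝ := fun j =>
    ∑ i, MvPolynomial.C (b i j) * MvPolynomial.X i
  let U : MvPolynomial (Fin (d + 1)) ℝ := ∑ i, MvPolynomial.X i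
  let h : MvPolynomial (Fin (d + 1)) ℝ := ∑ γ ∈ q.support,
    MvPolynomial.C (q.coeff γ) * ((∏ j, X j ^ γ j) * U ^ (k - ∑ j, γ j))
  have hX : ∀ j, (X j).IsHomogeneous 1 := fun j =>
    MvPolynomial.IsHomogeneous.sum _ _ _ fun i _ =>
      (MvPolynomial.isHomogeneous_X ℝ i).C_mul _
  have hU : U.IsHomogeneous 1 :=
    MvPolynomial.IsHomogeneous.sum _ _ _ fun i _ => MvPolynomial.isHomogeneous_X ℝ i
  have hh : h.IsHomogeneous k := by
    refine MvPolynomial.IsHomogeneous.sum _ _ _ fun γ hγ => MvPolynomial.IsHomogeneous.C_mul ?_ _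
    have hdeg : ∑ j, γ j ≤ k := by
      have := MvPolynomial.le_totalDegree hγ
      rw [Finsupp.sum_fintype _ _ (by simp)] at this
      omega
    have h1 := (MvPolynomial.IsHomogeneous.prod univ (fun j => X j ^ γ j) (fun j => 1 * γ j)
      fun j _ => (hX j).pow (γ j)).mul (hU.pow (k - ∑ j, γ j))
    convert! h1 using 1
    simp
    omega
  have heval : ∀ y : E d, MvPolynomial.eval (fun i => b.coord i y) h = polyFun d q y := by
    intro y
    have hXe : ∀ j, MvPolynomial.eval (fun i => b.coord i y) (X j) = y j := by
      intro j
      have hy := congrArg (fun z : E d => z j) (b.linear_combination_coord_eq_self y)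
      simp only [WithLp.ofLp_sum, WithLp.ofLp_smul, Finset.sum_apply, Pi.smul_apply,
        smul_eq_mul] at hy
      rw [← hy]
      simp [X, mul_comm]
    have hUe : MvPolynomial.eval (fun i => b.coord i y) U = 1 := by
      simp [U, b.sum_coord_apply_eq_one y]
    simp only [h, map_sum, map_mul, map_prod, map_pow, hXe, hUe, MvPolynomial.eval_C, one_pow,
      mul_one]
    exact (MvPolynomial.eval_eq' _ q).symm
  refine ⟨fun α => h.coeff (Finsupp.equivFunOnFinite.symm α), ?_⟩
  ext y
  rw [← heval, MvPolynomial.eval_eq', baryPoly]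
  refine sum_bij_ne_zero (fun γ _ _ => ⇑γ) ?_ ?_ ?_ ?_
  · intro γ hγ _
    have := hh.degree_eq_sum_deg_support hγ
    rw [mem_multiIndex, this]
    refine (sum_subset (subset_univ _) fun i _ hi => ?_).symm
    simpa using hi
  · intro γ _ _ γ' _ _ hγ
    exact DFunLike.coe_injective hγ
  · intro α _ hα
    refine ⟨Finsupp.equivFunOnFinite.symm α, ?_, ?_, rfl⟩
    · rw [MvPolynomial.mem_support_iff]
      exact left_ne_zero_of_mul hα
    · exact hα
  · intro γ _ _
    simp [baryMono]

end Monomial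

/-! ### Interpolation on the principal lattice -/

/-- A homogeneous polynomial of degree `S` is determined by its values at the points
`(R_i + 1)_i`, where `R` runs over the multi-indices with sum `S`. -/
theorem eq_zero_of_sum_lattice_eq_zero {σ : Type*} [Fintype σ] [DecidableEq σ] [Nonempty σ] (S : ℕ)
    (c : (σ → ℕ) → ℝ)
    (h : ∀ R' ∈ piAntidiag (univ : Finset σ) S,
      ∑ R ∈ piAntidiag univ S, c R * ∏ i, ((R' i : ℝ) + 1) ^ R i = 0) :
    ∀ R ∈ piAntidiag (univ : Finset σ) S, c R = 0 := by
  let P := {R : σ → ℕ // R ∈ piAntidiag (univ : Finset σ) S}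
  let T : ℝ := S + Fintype.card σ
  have hT : T ≠ 0 := by
    have : 0 < Fintype.card σ := Fintype.card_pos
    positivity
  have hmem : ∀ R : σ → ℕ, R ∈ piAntidiag (univ : Finset σ) S ↔ ∑ i, R i = S := by simp
  -- Lagrange polynomials, made homogeneous by writing constants as multiples of ∑ X_l. At R' + 1
  -- this sum is T and the factors become R'_i - j with j < R_i. One of them vanishes if R' ≠ R,
  -- since the sums agree and thus R'_i < R_i for some i.
  let q : (σ → ℕ) → MvPolynomial σ ℝ := fun R => ∏ i, ∏ j ∈ range (R i),
    (MvPolynomial.X i - MvPolynomial.C (((j : ℝ) + 1) / T) * ∑ l, MvPolynomial.X l)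
  let pt : (σ → ℕ) → σ → ℝ := fun R i => (R i : ℝ) + 1
  have hq : ∀ R : P, (q R).IsHomogeneous S := by
    intro R
    have h1 := MvPolynomial.IsHomogeneous.prod (univ : Finset σ) (fun i => ∏ j ∈ range (R.1 i),
      (MvPolynomial.X i - MvPolynomial.C (((j : ℝ) + 1) / T) * ∑ l, MvPolynomial.X l))
      (fun i => R.1 i) fun i _ => by
        have h2 := MvPolynomial.IsHomogeneous.prod (range (R.1 i)) (fun j : ℕ =>
          (MvPolynomial.X i - MvPolynomial.C (((j : ℝ) + 1) / T) * ∑ l, MvPolynomial.X l))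
          (fun _ => 1) fun j _ => (MvPolynomial.isHomogeneous_X ℝ i).sub
            (MvPolynomial.IsHomogeneous.C_mul
              (MvPolynomial.IsHomogeneous.sum _ _ _ fun l _ => MvPolynomial.isHomogeneous_X ℝ l) _)
        simpa using h2
    rwa [(hmem _).1 R.2] at h1
  have heval : ∀ R R' : P, MvPolynomial.eval (pt R') (q R) =
      ∏ i, ∏ j ∈ range (R.1 i), ((R'.1 i : ℝ) - j) := by
    intro R R'
    have hs : ∑ l, pt R'.1 l = T := by
      have := (hmem _).1 R'.2
      simp only [pt, sum_add_distrib, T, ← this]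
      simp
    simp only [q, map_prod, map_sub, map_mul, map_sum, MvPolynomial.eval_X, MvPolynomial.eval_C, hs]
    refine prod_congr rfl fun i _ => prod_congr rfl fun j _ => ?_
    rw [div_mul_cancel₀ _ hT]
    simp [pt]
  have hdiag : ∀ R : P, MvPolynomial.eval (pt R) (q R) ≠ 0 := by
    intro R
    rw [heval]
    refine prod_ne_zero_iff.2 fun i _ => prod_ne_zero_iff.2 fun j hj => ?_
    rw [sub_ne_zero]
    exact_mod_cast (mem_range.1 hj).ne'
  have hoff : ∀ R R' : P, R' ≠ R → MvPolynomial.eval (pt R') (q R) = 0 := by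
    intro R R' hne
    rw [heval]
    obtain ⟨i, hi⟩ : ∃ i, R'.1 i < R.1 i := by
      by_contra! hle
      have h1 := (sum_eq_sum_iff_of_le (s := univ) fun i _ => hle i).1
        (((hmem _).1 R.2).trans ((hmem _).1 R'.2).symm)
      exact hne (Subtype.ext (funext fun i => (h1 i (mem_univ i)).symm))
    exact prod_eq_zero (mem_univ i) (prod_eq_zero (mem_range.2 hi) (sub_self _))
  -- A is the collocation matrix, and the columns of B are the coefficients of the normalized q.
  -- From A B = 1 follows B A = 1 because A is square.
  let A : Matrix P P ℝ := fun R' R => ∏ i, ((R'.1 i : ℝ) + 1) ^ R.1 i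
  let B : Matrix P P ℝ := fun R R'' =>
    (q R'').coeff (Finsupp.equivFunOnFinite.symm R.1) * (MvPolynomial.eval (pt R'') (q R''))⁻¹
  have hAB : A * B = 1 := by
    ext R' R''
    have h1 : MvPolynomial.eval (pt R') (q R'') =
        ∑ R : P, A R' R * (q R'').coeff (Finsupp.equivFunOnFinite.symm R.1) := by
      rw [MvPolynomial.eval_eq']
      have h3 := sum_coe_sort (piAntidiag (univ : Finset σ) S) fun R =>
        (∏ i, ((R'.1 i : ℝ) + 1) ^ R i) * (q R'').coeff (Finsupp.equivFunOnFinite.symm R)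
      refine Eq.trans ?_ h3.symm
      refine sum_bij_ne_zero (fun γ _ _ => ⇑γ) ?_ ?_ ?_ ?_
      · intro γ hγ _
        rw [hmem, (hq R'').degree_eq_sum_deg_support hγ]
        exact (sum_subset (subset_univ _) fun i _ hi => by simpa using hi).symm
      · intro γ _ _ γ' _ _ hγ
        exact DFunLike.coe_injective hγ
      · intro R _ hR
        refine ⟨Finsupp.equivFunOnFinite.symm R, ?_, ?_, rfl⟩
        · rw [MvPolynomial.mem_support_iff]
          exact right_ne_zero_of_mul hR
        · rw [mul_comm]
          exact hR
      · intro γ _ _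
        rw [mul_comm]
        simp [pt]
    have h2 : (A * B) R' R'' =
        MvPolynomial.eval (pt R') (q R'') * (MvPolynomial.eval (pt R'') (q R''))⁻¹ := by
      rw [h1, Matrix.mul_apply, sum_mul]
      exact sum_congr rfl fun R _ => by simp only [B]; ring
    rw [h2]
    by_cases hR : R' = R''
    · subst hR
      rw [Matrix.one_apply_eq, mul_inv_cancel₀ (hdiag _)]
    · rw [Matrix.one_apply_ne hR, hoff _ _ hR, zero_mul]
  have hBA := mul_eq_one_comm.1 hAB
  have hAc : A.mulVec (fun R : P => c R.1) = 0 := by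
    ext R'
    have h1 := h R'.1 R'.2
    rw [← sum_attach] at h1
    rw [Matrix.mulVec, dotProduct]
    simp only [A, Pi.zero_apply]
    rw [← h1]
    exact sum_congr rfl fun R _ => mul_comm _ _
  have hc0 : (fun R : P => c R.1) = 0 := by
    rw [← Matrix.one_mulVec (fun R : P => c R.1), ← hBA, ← Matrix.mulVec_mulVec, hAc,
      Matrix.mulVec_zero]
  intro R hR
  exact congrFun hc0 ⟨R, hR⟩

/-! ### Interpolation over the multi-indices that share N' and the components on it -/

section Group

variable {d k : ℕ} {r : ℕ → ℕ} {α₀ : Fin (d + 1) → ℕ} {M : Finset (Fin (d + 1))}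

/-- The multi-indices with `N'(α) = M` that agree with `α₀` on `M`. -/
def dualGroup (k : ℕ) (r : ℕ → ℕ) (M : Finset (Fin (d + 1))) (α₀ : Fin (d + 1) → ℕ) :
    Finset (Fin (d + 1) → ℕ) :=
  (multiIndex d k).filter fun α => dualN k r α = M ∧ ∀ i ∈ M, α i = α₀ i

theorem mem_dualGroup {α : Fin (d + 1) → ℕ} : α ∈ dualGroup k r M α₀ ↔
    α ∈ multiIndex d k ∧ dualN k r α = M ∧ ∀ i ∈ M, α i = α₀ i := by
  simp [dualGroup]

theorem Admissible.nodeCoord_pos (h : Admissible d k r) {α : Fin (d + 1) → ℕ}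
    (hα : α ∈ multiIndex d k) {i : Fin (d + 1)} (hi : i ∉ dualN k r α) :
    0 < nodeCoord k r α i := by
  have h1 := h.one_le_sub_nodeShift hα hi
  have h2 := h.nodeDenom_pos hα
  rw [nodeCoord_eq hα, if_pos (by simpa [dualDelta] using hi)]
  exact div_pos (by exact_mod_cast (by omega)) (by exact_mod_cast h2)

/-- Interpolation at the nodes with given `N'(α)` and given components on `N'(α)`. -/
theorem Admissible.eq_zero_of_dualGroup (h : Admissible d k r) (hM : IsDualN k r α₀ M)
    (c : (Fin (d + 1) → ℕ) → ℝ)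
    (hc : ∀ α ∈ dualGroup k r M α₀,
      ∑ α' ∈ dualGroup k r M α₀, c α' * ∏ i ∈ Mᶜ, nodeCoord k r α i ^ α' i = 0) :
    c α₀ = 0 := by
  have hα₀ : α₀ ∈ multiIndex d k := hM.2.1.1.1
  have hα₀g : α₀ ∈ dualGroup k r M α₀ := mem_dualGroup.2 ⟨hα₀, h.dualN_eq hM, fun _ _ => rfl⟩
  rcases hM.1.lt_or_eq with hd | hd
  swap
  -- If M has d elements, the sum k fixes the remaining component, so the group has one member.
  · obtain ⟨i₀, hi₀⟩ : ∃ i, Mᶜ = {i} := card_eq_one.1 (by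
      rw [card_compl, Fintype.card_fin]; omega)
    have hsing : dualGroup k r M α₀ = {α₀} := by
      refine eq_singleton_iff_unique_mem.2 ⟨hα₀g, fun α hα => ?_⟩
      obtain ⟨h1, -, h2⟩ := mem_dualGroup.1 hα
      have h3 := mem_multiIndex.1 h1
      have h4 := mem_multiIndex.1 hα₀
      rw [← sum_add_sum_compl M, hi₀, sum_singleton,
        show ∑ i ∈ M, α i = ∑ i ∈ M, α₀ i from sum_congr rfl h2] at h3
      rw [← sum_add_sum_compl M, hi₀, sum_singleton] at h4
      ext i
      by_cases hi : i ∈ M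
      · exact h2 i hi
      · have : i = i₀ := by simpa [hi₀] using mem_compl.2 hi
        subst this
        omega
    have h1 := hc α₀ hα₀g
    rw [hsing, sum_singleton] at h1
    refine (mul_eq_zero.1 h1).resolve_right (prod_ne_zero_iff.2 fun i hi => ?_)
    exact pow_ne_zero _ (h.nodeCoord_pos hα₀ (by rw [h.dualN_eq hM]; simpa using hi)).ne'
  classical
  obtain ⟨n, hn₀⟩ : ∃ n, n = ∑ i ∈ M, α₀ i := ⟨_, rfl⟩
  have hsM : ∀ f : Fin (d + 1) → ℕ, (∀ i ∈ M, f i = α₀ i) → ∑ i ∈ M, f i = n :=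
    fun f hf => (sum_congr rfl hf).trans hn₀.symm
  have hn : n ≤ r (M.card + 1) := by
    rw [hn₀]
    rcases Nat.eq_zero_or_pos M.card with h0 | h0
    · simp [card_eq_zero.1 h0]
    · exact hM.2.2.trans (h.mono h0 (by omega) (by omega))
  -- C is the least value that `lt_of_notMem` allows outside M. Subtracting it leaves exactly the
  -- multi-indices R on the complement with sum S, and the nodes become (R_i + 1) / T.
  obtain ⟨C, hC₀⟩ : ∃ C, C = r (M.card + 1) - n + 1 := ⟨_, rfl⟩
  let σ := {i : Fin (d + 1) // i ∉ M}
  have : Nonempty σ := by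
    obtain ⟨i, hi⟩ := card_pos.1 (card_compl_pos hM)
    exact ⟨⟨i, by simpa using hi⟩⟩
  have hsumσ : ∀ f : Fin (d + 1) → ℕ, ∑ i, f i = ∑ i ∈ M, f i + ∑ i : σ, f i := by
    intro f
    rw [← sum_add_sum_compl M, sum_subtype (p := fun i => i ∉ M) Mᶜ (by simp)]
  have hC : ∀ α ∈ dualGroup k r M α₀, ∀ i ∉ M, C ≤ α i := by
    intro α hα i hi
    obtain ⟨h1, h2, h3⟩ := mem_dualGroup.1 hα
    have hMα := isDualN_dualN (r := r) h1
    rw [h2] at hMα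
    have h4 := hMα.lt_of_notMem hd hi
    rw [hsM _ h3] at h4
    omega
  obtain ⟨S, hS⟩ : ∃ S, n + (S + Fintype.card σ * C) = k := by
    have h1 := mem_multiIndex.1 hα₀
    rw [hsumσ, hsM _ fun _ _ => rfl] at h1
    have h2 : Fintype.card σ * C ≤ ∑ i : σ, α₀ i := by
      rw [← smul_eq_mul, ← Finset.card_univ, ← sum_const]
      exact sum_le_sum fun i _ => hC α₀ hα₀g i.1 i.2
    exact ⟨k - n - Fintype.card σ * C, by omega⟩
  let ext : (σ → ℕ) → Fin (d + 1) → ℕ := fun R i => if hi : i ∈ M then α₀ i else R ⟨i, hi⟩ + C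
  have hextM : ∀ R, ∀ i ∈ M, ext R i = α₀ i := fun R i hi => by simp [ext, hi]
  have hextσ : ∀ R, ∀ i : σ, ext R i = R i + C := fun R i => by simp [ext, i.2]
  have hext : ∀ R ∈ piAntidiag (univ : Finset σ) S, ext R ∈ dualGroup k r M α₀ := by
    intro R hR
    have hRS : ∑ i, R i = S := by simpa using hR
    have hmem : ext R ∈ multiIndex d k := by
      rw [mem_multiIndex, hsumσ, hsM _ (hextM R), sum_congr rfl fun i _ => hextσ R i,
        sum_add_distrib, hRS]
      simp only [sum_const, Finset.card_univ, smul_eq_mul]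
      exact hS
    have hdual : IsDualN k r (ext R) M := by
      refine h.isDualN_of_lt ⟨hmem, fun t ht htM => ?_⟩ hM.1 ?_ fun _ i hi => ?_
      · obtain ⟨X, hXM, hX, hXs⟩ := h.exists_subset hM ht htM
        exact ⟨X, hX, by rwa [sum_congr rfl fun i hi => hextM R i (hXM hi)]⟩
      · rw [hsM _ (hextM R), hn₀]
        exact hM.2.2
      · rw [hsM _ (hextM R), hextσ R ⟨i, hi⟩]
        omega
    exact mem_dualGroup.2 ⟨hmem, h.dualN_eq hdual, hextM R⟩
  let res : (Fin (d + 1) → ℕ) → σ → ℕ := fun α i => α i - C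
  have hres : ∀ α ∈ dualGroup k r M α₀, res α ∈ piAntidiag (univ : Finset σ) S ∧
      ext (res α) = α := by
    intro α hα
    have he : ext (res α) = α := by
      ext i
      by_cases hi : i ∈ M
      · rw [hextM _ i hi, (mem_dualGroup.1 hα).2.2 i hi]
      · have := hC α hα i hi
        rw [hextσ _ ⟨i, hi⟩]
        simp only [res]
        omega
    refine ⟨?_, he⟩
    have h1 := mem_multiIndex.1 (mem_dualGroup.1 hα).1
    rw [← he, hsumσ, hsM _ (hextM _), sum_congr rfl fun i _ => hextσ _ i,
        sum_add_distrib] at h1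
    simp only [sum_const, Finset.card_univ, smul_eq_mul] at h1
    simp only [mem_piAntidiag, mem_univ, implies_true, and_true]
    change ∑ i, res α i = S
    omega
  let T : ℝ := S + Fintype.card σ
  have hnode : ∀ R ∈ piAntidiag (univ : Finset σ) S, ∀ i : σ,
      nodeCoord k r (ext R) i = ((R i : ℝ) + 1) * T⁻¹ := by
    intro R hR i
    obtain ⟨h1, h2, h3⟩ := mem_dualGroup.1 (hext R hR)
    have ho : dualOrder k r (ext R) = n := by rw [dualOrder, h2, hsM _ h3]
    have hshift : nodeShift k r (ext R) = C := by
      rw [nodeShift, h2, if_pos hd, ho]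
      omega
    have hnum : ∀ i : σ, ((ext R i : ℕ) : ℤ) - nodeShift k r (ext R) + 1 = (R i : ℤ) + 1 := by
      intro i
      rw [hshift, hextσ]
      push_cast
      ring
    have hsum : ∑ i, R i = S := by simpa using hR
    have hden : ∑ i ∈ dualDelta k r (ext R), (((ext R i : ℕ) : ℤ) - nodeShift k r (ext R) + 1) =
        S + Fintype.card σ := by
      have hsub : ∀ f : Fin (d + 1) → ℤ, ∑ i ∈ Mᶜ, f i = ∑ i : σ, f i :=
        fun f => sum_subtype _ (by simp) f
      rw [dualDelta, h2, hsub,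
        sum_congr rfl fun i _ => hnum i, sum_add_distrib, ← hsum]
      simp
    rw [nodeCoord_eq h1, if_pos (by simpa [dualDelta, h2] using i.2), hden, hnum, div_eq_mul_inv]
    push_cast
    rfl
  have hTpos : 0 < T := by
    have : 0 < Fintype.card σ := Fintype.card_pos
    positivity
  have key := eq_zero_of_sum_lattice_eq_zero S (fun R => c (ext R)) fun R' hR' => by
    have h1 := hc (ext R') (hext R' hR')
    -- The powers with exponent C and the power of T depend only on the node, so they come out as a
    -- common nonzero factor.
    have h2 : ∑ α' ∈ dualGroup k r M α₀, c α' * ∏ i ∈ Mᶜ, nodeCoord k r (ext R') i ^ α' i =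
        ∑ R ∈ piAntidiag (univ : Finset σ) S, (c (ext R) * ∏ i, ((R' i : ℝ) + 1) ^ R i) *
          ((∏ i : σ, (((R' i : ℝ) + 1) * T⁻¹) ^ C) * T⁻¹ ^ S) := by
      refine sum_nbij' res ext (fun α hα => (hres α hα).1) hext (fun α hα => (hres α hα).2)
        (fun R _ => ?_) fun α hα => ?_
      · ext i
        simp only [res]
        rw [hextσ]
        omega
      · rw [(hres α hα).2, mul_assoc]
        congr 1
        have hsum : ∑ i, res α i = S := by simpa using (hres α hα).1
        rw [prod_subtype (p := fun i => i ∉ M) Mᶜ (by simp), ← hsum, ← prod_pow_eq_pow_sum,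
          ← prod_mul_distrib, ← prod_mul_distrib]
        refine prod_congr rfl fun i _ => ?_
        have h3 : α i = res α i + C := by
          conv_lhs => rw [← (hres α hα).2]
          exact hextσ _ i
        rw [hnode R' hR', h3, pow_add, mul_pow, mul_pow]
        ring
    rw [h2, ← sum_mul] at h1
    refine (mul_eq_zero.1 h1).resolve_right (mul_ne_zero ?_ (pow_ne_zero _ (inv_ne_zero hTpos.ne')))
    exact prod_ne_zero_iff.2 fun i _ => pow_ne_zero _
      (mul_ne_zero (by positivity) (inv_ne_zero hTpos.ne'))
  have := key (res α₀) (hres α₀ hα₀g).1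
  rwa [(hres α₀ hα₀g).2] at this

end Group

/-! ### Normal vectors of faces -/

section Geometry

variable {d : ℕ} {x x' : Fin (d + 1) → E d} {G : Finset (Fin (d + 1))} {i j : Fin (d + 1)}

/-- The affine basis formed by the vertices of a nondegenerate simplex. -/
def simplexBasis (x : Fin (d + 1) → E d) (hx : AffineIndependent ℝ x) :
    AffineBasis (Fin (d + 1)) ℝ (E d) :=
  ⟨x, hx, by rw [hx.affineSpan_eq_top_iff_card_eq_finrank_add_one]; simp⟩

/-- The tangent space of the face with vertices `x_j`, `j ∈ G`. -/
abbrev faceSpan (x : Fin (d + 1) → E d) (G : Finset (Fin (d + 1))) : Submodule ℝ (E d) :=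
  vectorSpan ℝ (x '' (G : Set (Fin (d + 1))))

theorem sub_mem_faceSpan (hi : i ∈ G) (hj : j ∈ G) : x i - x j ∈ faceSpan x G :=
  vsub_mem_vectorSpan ℝ (Set.mem_image_of_mem x hi) (Set.mem_image_of_mem x hj)

/-- The vector from the barycenter of a face to a vertex. -/
def fromCenter (x : Fin (d + 1) → E d) (G : Finset (Fin (d + 1))) (i : Fin (d + 1)) : E d :=
  x i - (G.card : ℝ)⁻¹ • ∑ j ∈ G, x j

theorem heightVec_eq : heightVec x G i = (faceSpan x G)ᗮ.starProjection (fromCenter x G i) := rfl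

theorem fromCenter_eq (hG : G.Nonempty) :
    fromCenter x G i = (G.card : ℝ)⁻¹ • ∑ j ∈ G, (x i - x j) := by
  have : (G.card : ℝ) ≠ 0 := by exact_mod_cast (card_pos.2 hG).ne'
  rw [sum_sub_distrib, sum_const, smul_sub, ← Nat.cast_smul_eq_nsmul ℝ, smul_smul,
    inv_mul_cancel₀ this, one_smul, fromCenter]

theorem fromCenter_mem (hG : G.Nonempty) (hi : i ∈ G) : fromCenter x G i ∈ faceSpan x G := by
  rw [fromCenter_eq hG]
  exact Submodule.smul_mem _ _ (Submodule.sum_mem _ fun j hj => sub_mem_faceSpan hi hj)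

theorem heightVec_mem : heightVec x G i ∈ (faceSpan x G)ᗮ :=
  Submodule.starProjection_apply_mem _ _

theorem fromCenter_sub_heightVec_mem : fromCenter x G i - heightVec x G i ∈ faceSpan x G := by
  rw [heightVec_eq]
  have h := Submodule.sub_starProjection_mem_orthogonal (K := (faceSpan x G)ᗮ) (fromCenter x G i)
  rwa [Submodule.orthogonal_orthogonal] at h

theorem outerNormal_mem : outerNormal x G i ∈ (faceSpan x G)ᗮ :=
  Submodule.neg_mem _ (Submodule.smul_mem _ _ heightVec_mem)

theorem outerNormal_congr (hG : ∀ j ∈ G, x j = x' j) (hi : x i = x' i) :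
    outerNormal x G i = outerNormal x' G i := by
  have h1 : x '' (G : Set (Fin (d + 1))) = x' '' (G : Set (Fin (d + 1))) :=
    Set.image_congr fun j hj => hG j hj
  have h2 : heightVec x G i = heightVec x' G i := by
    unfold heightVec
    rw [hi, sum_congr rfl hG]
    simp only [h1]
  rw [outerNormal, outerNormal, h2]

theorem faceSpan_congr (hG : ∀ j ∈ G, x j = x' j) : faceSpan x G = faceSpan x' G := by
  have h1 : x '' (G : Set (Fin (d + 1))) = x' '' (G : Set (Fin (d + 1))) :=
    Set.image_congr fun j hj => hG j hj
  rw [faceSpan, h1]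

variable (b : AffineBasis (Fin (d + 1)) ℝ (E d))

theorem coordLin_sub (v w : E d) : coordLin b i (v - w) = b.coord i v - b.coord i w :=
  (b.coord i).linearMap_vsub v w

theorem coordLin_of_mem_faceSpan {v : E d} (hv : v ∈ faceSpan b G) (hj : j ∉ G) :
    coordLin b j v = 0 := by
  refine LinearMap.mem_ker.1 (Submodule.span_le.2 ?_ hv)
  rintro _ ⟨_, ⟨i, hi, rfl⟩, _, ⟨l, hl, rfl⟩, rfl⟩
  have hji : j ≠ i := fun h => hj (h ▸ hi)
  have hjl : j ≠ l := fun h => hj (h ▸ hl)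
  simp only [vsub_eq_sub, SetLike.mem_coe, LinearMap.mem_ker, coordLin_sub]
  rw [b.coord_apply_ne hji, b.coord_apply_ne hjl, sub_zero]

theorem coordLin_fromCenter (hG : G.Nonempty) (hj : j ∉ G) :
    coordLin b j (fromCenter b G i) = if j = i then 1 else 0 := by
  have hc : (G.card : ℝ) ≠ 0 := by exact_mod_cast (card_pos.2 hG).ne'
  rw [fromCenter_eq hG, map_smul, map_sum]
  have : ∀ l ∈ G, coordLin b j (b i - b l) = if j = i then 1 else 0 := by
    intro l hl
    have hjl : j ≠ l := fun h => hj (h ▸ hl)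
    rw [coordLin_sub, b.coord_apply_ne hjl, sub_zero, b.coord_apply]
  rw [sum_congr rfl this, sum_const, nsmul_eq_mul, smul_eq_mul, inv_mul_cancel_left₀ hc]

/-- The projection changes the vector only by a tangent vector of the face, along which λ_j with j ∉
G is constant. -/
theorem coordLin_heightVec (hG : G.Nonempty) (hj : j ∉ G) :
    coordLin b j (heightVec b G i) = if j = i then 1 else 0 := by
  rw [← coordLin_fromCenter b hG hj, eq_comm, ← sub_eq_zero, ← map_sub]
  exact coordLin_of_mem_faceSpan b fromCenter_sub_heightVec_mem hj

theorem norm_heightVec_ne_zero (hG : G.Nonempty) (hi : i ∉ G) : ‖heightVec b G i‖ ≠ 0 := by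
  rw [norm_ne_zero_iff]
  intro h
  have := coordLin_heightVec (i := i) b hG hi
  rw [h, map_zero, if_pos rfl] at this
  exact zero_ne_one this

theorem coordLin_outerNormal_of_ne (hG : G.Nonempty) (hj : j ∉ G) (hij : j ≠ i) :
    coordLin b j (outerNormal b G i) = 0 := by
  rw [outerNormal, map_neg, map_smul, coordLin_heightVec b hG hj, if_neg hij, smul_zero, neg_zero]

theorem coordLin_outerNormal_ne_zero (hG : G.Nonempty) (hi : i ∉ G) :
    coordLin b i (outerNormal b G i) ≠ 0 := by
  rw [outerNormal, map_neg, map_smul, coordLin_heightVec b hG hi, if_pos rfl]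
  simpa using norm_heightVec_ne_zero b hG hi

theorem eq_sum_coordLin_smul (v : E d) (z : E d) : v = ∑ i, coordLin b i v • (b i - z) := by
  have h1 : ∀ i, coordLin b i v = b.coord i v - b.coord i 0 := fun i => by
    rw [← coordLin_sub, sub_zero]
  simp_rw [smul_sub, sum_sub_distrib, ← sum_smul, h1, sub_smul, sum_sub_distrib,
    b.linear_combination_coord_eq_self, b.sum_coord_apply_eq_one]
  simp

/-- Expand v in the vectors from the barycenter of the face to the vertices and project: v is fixed,
and the terms with i ∈ G, being tangent, disappear. -/
theorem mem_span_outerNormal (hG : G.Nonempty) {v : E d} (hv : v ∈ (faceSpan b G)ᗮ) :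
    v ∈ Submodule.span ℝ (outerNormal b G '' {i | i ∉ G}) := by
  have h1 : v = ∑ i, coordLin b i v • heightVec b G i := by
    conv_lhs => rw [← Submodule.starProjection_eq_self_iff.2 hv,
      eq_sum_coordLin_smul b v ((G.card : ℝ)⁻¹ • ∑ j ∈ G, b j)]
    rw [map_sum]
    exact sum_congr rfl fun i _ => by rw [map_smul]; rfl
  rw [h1]
  refine Submodule.sum_mem _ fun i _ => Submodule.smul_mem _ _ ?_
  by_cases hi : i ∈ G
  · have : heightVec b G i = 0 := by
      rw [heightVec_eq, Submodule.starProjection_apply_eq_zero_iff,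
        Submodule.orthogonal_orthogonal]
      exact fromCenter_mem hG hi
    rw [this]
    exact Submodule.zero_mem _
  · have : heightVec b G i = (-‖heightVec b G i‖) • outerNormal b G i := by
      rw [outerNormal, smul_neg, neg_smul, neg_neg, smul_smul,
        mul_inv_cancel₀ (norm_heightVec_ne_zero b hG hi), one_smul]
    rw [this]
    exact Submodule.smul_mem _ _ (Submodule.subset_span ⟨i, hi, rfl⟩)

end Geometry

/-! ### Degrees of freedom of barycentric polynomials -/

section Dof

variable {d k : ℕ} {r : ℕ → ℕ} {α α' : Fin (d + 1) → ℕ} {M : Finset (Fin (d + 1))}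

/-- The indices `i ∈ M`, each repeated `α_i` times. -/
def dirIndices (M : Finset (Fin (d + 1))) (α : Fin (d + 1) → ℕ) : List (Fin (d + 1)) :=
  (List.finRange (d + 1)).flatMap fun i => if i ∈ M then List.replicate (α i) i else []

theorem directions_eq (x : Fin (d + 1) → E d) (α : Fin (d + 1) → ℕ) :
    directions x k r α =
      (dirIndices (dualN k r α) α).map (outerNormal x (dualDelta k r α)) := by
  rw [dirIndices, List.map_flatMap, directions]
  congr 1
  ext1 i
  split_ifs <;> simp

theorem dirIndices_congr (h : ∀ i ∈ M, α i = α' i) : dirIndices M α = dirIndices M α' := by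
  unfold dirIndices
  congr 1
  ext1 i
  split_ifs with hi
  · rw [h i hi]
  · rfl

theorem count_dirIndices (i : Fin (d + 1)) :
    (dirIndices M α).count i = if i ∈ M then α i else 0 := by
  rw [dirIndices, List.count_flatMap, ← Fin.sum_univ_def, sum_eq_single i]
  · simp only [Function.comp]
    split_ifs <;> simp
  · intro j _ hj
    simp only [Function.comp]
    split_ifs <;> simp [List.count_replicate, hj]
  · simp

theorem mem_of_mem_dirIndices {i : Fin (d + 1)} (hi : i ∈ dirIndices M α) : i ∈ M := by
  by_contra h
  have := List.count_pos_iff.2 hi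
  rw [count_dirIndices, if_neg h] at this
  exact lt_irrefl _ this

theorem length_eq_sum_count (l : List (Fin (d + 1))) : l.length = ∑ i, l.count i := by
  induction l with
  | nil => simp
  | cons a l ih => simp [List.count_cons, sum_add_distrib, ih]

theorem length_dirIndices : (dirIndices M α).length = ∑ i ∈ M, α i := by
  rw [length_eq_sum_count]
  simp_rw [count_dirIndices]
  rw [sum_ite_mem, univ_inter]

theorem length_directions (x : Fin (d + 1) → E d) :
    (directions x k r α).length = dualOrder k r α := by
  rw [directions_eq, List.length_map, length_dirIndices]
  rfl

theorem dof_eq_jet (x : Fin (d + 1) → E d) (u : E d → ℝ) :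
    dof x k r α u = jet (convexHull ℝ (Set.range x)) u (directions x k r α) (node x k r α) := rfl

variable (b : AffineBasis (Fin (d + 1)) ℝ (E d))

theorem interior_simplex_nonempty : (interior (convexHull ℝ (Set.range b))).Nonempty := by
  rw [interior_convexHull_nonempty_iff_affineSpan_eq_top]
  exact b.tot

theorem uniqueDiffOn_simplex : UniqueDiffOn ℝ (convexHull ℝ (Set.range b)) :=
  uniqueDiffOn_convex (convex_convexHull ℝ _) (interior_simplex_nonempty b)

theorem Admissible.coord_node (h : Admissible d k r) (hα : α ∈ multiIndex d k) (i : Fin (d + 1)) :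
    b.coord i (node b k r α) = nodeCoord k r α i := by
  have h1 := b.coord_apply_combination_of_mem (mem_univ i) (h.sum_nodeCoord hα)
  rwa [univ.affineCombination_eq_linear_combination _ _ (h.sum_nodeCoord hα)] at h1

theorem Admissible.node_mem (h : Admissible d k r) (hα : α ∈ multiIndex d k) :
    node b k r α ∈ convexHull ℝ (Set.range b) := by
  rw [b.convexHull_eq_nonneg_coord]
  intro i
  rw [h.coord_node b hα]
  exact h.nodeCoord_nonneg hα i

theorem dualOrder_le (hα : α ∈ multiIndex d k) : dualOrder k r α ≤ k := by
  rw [← mem_multiIndex.1 hα]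
  exact sum_le_sum_of_subset (subset_univ _)

theorem Admissible.dualOrder_le_r (h : Admissible d k r) (hα : α ∈ multiIndex d k) :
    dualOrder k r α ≤ r d := by
  have hM := isDualN_dualN (r := r) hα
  rcases Nat.eq_zero_or_pos (dualN k r α).card with h0 | h0
  · simp [dualOrder, card_eq_zero.1 h0]
  · exact hM.2.2.trans (h.mono h0 hM.1 le_rfl)

/-- If the degrees of freedom in a lower closed set of indices vanish on a polynomial, then so do
its barycentric coefficients. -/
theorem Admissible.coeff_eq_zero (h : Admissible d k r) (A : Set (Fin (d + 1) → ℕ))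
    (hA : ∀ α ∈ multiIndex d k, α ∈ A → ∀ α' ∈ multiIndex d k,
      (∀ i ∈ dualN k r α, α' i ≤ α i) → α' ∈ A)
    (c : (Fin (d + 1) → ℕ) → ℝ)
    (hc : ∀ α ∈ multiIndex d k, α ∈ A → dof b k r α (baryPoly b k c) = 0) :
    ∀ α ∈ multiIndex d k, α ∈ A → c α = 0 := by
  -- Lexicographic induction, larger N' first and then smaller n'; the weight k + 1 exceeds every
  -- n'.
  have hind : ∀ n, ∀ α ∈ multiIndex d k, α ∈ A →
      (d - (dualN k r α).card) * (k + 1) + dualOrder k r α = n → c α = 0 := by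
    intro n
    induction n using Nat.strong_induction_on with
    | _ n ih =>
    intro α₀ hα₀ hα₀A hn
    have hM := isDualN_dualN (r := r) hα₀
    obtain ⟨M, hMdef⟩ : ∃ M, M = dualN k r α₀ := ⟨_, rfl⟩
    rw [← hMdef] at hM
    have hMc : Mᶜ.Nonempty := card_pos.1 (card_compl_pos hM)
    have hm : ∀ i ∈ M, ∀ j ∈ M, j ≠ i → coordLin b j (outerNormal b Mᶜ i) = 0 :=
      fun i _ j hj hji => coordLin_outerNormal_of_ne b hMc (by simpa using hj) hji
    have hm0 : ∀ i ∈ M, coordLin b i (outerNormal b Mᶜ i) ≠ 0 :=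
      fun i hi => coordLin_outerNormal_ne_zero b hMc (by simpa using hi)
    have hjs : ∀ j ∈ dirIndices M α₀, j ∈ M := fun j hj => mem_of_mem_dirIndices hj
    obtain ⟨C, hC, hCeq⟩ := exists_jet_baryMono_eq b hm hm0 (dirIndices M α₀) hjs
    have hconv := convex_convexHull ℝ (Set.range b)
    have hint := interior_simplex_nonempty b
    refine h.eq_zero_of_dualGroup hM c fun α hα => ?_
    obtain ⟨hαk, hαM, hαeq⟩ := mem_dualGroup.1 hα
    have hnode := h.node_mem b hαk
    have hcoord : ∀ i ∈ M, b.coord i (node b k r α) = 0 := fun i hi => by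
      rw [h.coord_node b hαk, nodeCoord_of_mem (by rwa [hαM])]
    have hαA : α ∈ A := hA α₀ hα₀ hα₀A α hαk fun i hi => (hαeq i (hMdef ▸ hi)).le
    have h1 := hc α hαk hαA
    rw [dof_eq_jet, directions_eq, dualDelta, hαM, dirIndices_congr hαeq,
      jet_baryPoly b hconv hint hnode] at h1
    -- Outside the group, either some exponent on M exceeds the number of derivatives along its
    -- normal, or α' precedes α₀ in the induction and c α' = 0.
    have h2 : ∑ α' ∈ dualGroup k r M α₀, c α' * jet (convexHull ℝ (Set.range b)) (baryMono b α')
        ((dirIndices M α₀).map (outerNormal b Mᶜ)) (node b k r α) = 0 := by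
      rw [← h1]
      refine sum_subset (filter_subset _ _) fun α' hα' hnot => ?_
      by_cases hle : ∀ i ∈ M, α' i ≤ α₀ i
      · rw [ih _ ?_ α' hα' (hA α₀ hα₀ hα₀A α' hα' (hMdef ▸ hle)) rfl, zero_mul]
        rw [← hn, ← hMdef]
        rcases h.dualN_of_le hM hα' hle with heq | hlt
        · rw [heq]
          have hne : ∃ i ∈ M, α' i < α₀ i := by
            by_contra! hge
            exact hnot (mem_dualGroup.2 ⟨hα', heq, fun i hi => le_antisymm (hle i hi) (hge i hi)⟩)
          have : dualOrder k r α' < dualOrder k r α₀ := by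
            rw [dualOrder, dualOrder, heq, ← hMdef]
            exact sum_lt_sum hle hne
          omega
        · have h3 := dualOrder_le (r := r) hα'
          have h4 := (isDualN_dualN (r := r) hα').1
          obtain ⟨e, he⟩ : ∃ e, d - M.card = d - (dualN k r α').card + 1 + e :=
            ⟨(dualN k r α').card - M.card - 1, by omega⟩
          rw [he, add_mul, add_mul]
          have : 0 ≤ e * (k + 1) := Nat.zero_le _
          omega
      · push Not at hle
        obtain ⟨i, hi, hlt⟩ := hle
        rw [jet_baryMono_eq_zero_of_count_lt b hconv hint hnode hcoord hm _ hjs hi, mul_zero]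
        rwa [count_dirIndices, if_pos hi]
    have h3 : C * ∑ α' ∈ dualGroup k r M α₀, c α' * ∏ i ∈ Mᶜ, nodeCoord k r α i ^ α' i = 0 := by
      rw [← h2, mul_sum]
      refine sum_congr rfl fun α' hα' => ?_
      rw [hCeq _ hconv hint _ hnode hcoord α' fun i hi => by
        rw [count_dirIndices, if_pos hi, (mem_dualGroup.1 hα').2.2 i hi],
        mul_left_comm]
      congr 2
      exact prod_congr rfl fun i _ => by rw [h.coord_node b hαk]
    exact (mul_eq_zero.1 h3).resolve_left hC
  exact fun α hα hαA => hind _ α hα hαA rfl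

/-! ### Unisolvence -/

theorem polySpace_contDiff {p : E d → ℝ} (hp : p ∈ polySpace d k) (n : WithTop ℕ∞)
    (b : AffineBasis (Fin (d + 1)) ℝ (E d)) : ContDiff ℝ n p := by
  obtain ⟨c, rfl⟩ := exists_baryPoly_eq b hp
  exact contDiff_baryPoly b c n

theorem Admissible.dof_baryPoly (h : Admissible d k r) (hα : α ∈ multiIndex d k)
    (c : (Fin (d + 1) → ℕ) → ℝ) : dof b k r α (baryPoly b k c) =
      ∑ α' ∈ multiIndex d k, c α' * dof b k r α (baryMono b α') :=
  jet_baryPoly b (convex_convexHull ℝ _) (interior_simplex_nonempty b) (h.node_mem b hα) c _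

/-- The polynomial with the given barycentric coefficients, as a linear map. -/
def ofCoeff (k : ℕ) : (multiIndex d k → ℝ) →ₗ[ℝ] polySpace d k where
  toFun c := ⟨∑ α : multiIndex d k, c α • baryMono b α,
    Submodule.sum_mem _ fun α _ => Submodule.smul_mem _ _ (baryMono_mem_polySpace b α.2)⟩
  map_add' c c' := by ext; simp [add_mul, sum_add_distrib]
  map_smul' a c := by ext; simp [mul_assoc, mul_sum]

theorem coe_ofCoeff (c : (Fin (d + 1) → ℕ) → ℝ) :
    (ofCoeff b k (fun α => c α) : E d → ℝ) = baryPoly b k c := by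
  ext y
  simp only [ofCoeff, LinearMap.coe_mk, AddHom.coe_mk, Finset.sum_apply, Pi.smul_apply, smul_eq_mul,
    baryPoly]
  exact sum_coe_sort (multiIndex d k) fun α => c α * baryMono b α y

theorem exists_extension (c : multiIndex d k → ℝ) :
    ∃ c' : (Fin (d + 1) → ℕ) → ℝ, c = fun α : multiIndex d k => c' α := by
  classical
  exact ⟨fun α => if hα : α ∈ multiIndex d k then c ⟨α, hα⟩ else 0, by ext α; simp⟩

theorem ofCoeff_surjective : Function.Surjective (ofCoeff b k) := by
  intro p
  obtain ⟨c, hc⟩ := exists_baryPoly_eq b p.2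
  exact ⟨fun α => c α, Subtype.ext ((coe_ofCoeff b c).trans hc.symm)⟩

/-- The degrees of freedom in terms of the barycentric coefficients. -/
def dofMap (k : ℕ) (r : ℕ → ℕ) : (multiIndex d k → ℝ) →ₗ[ℝ] (multiIndex d k → ℝ) where
  toFun c α := ∑ α' : multiIndex d k, c α' * dof b k r α (baryMono b α')
  map_add' c c' := by ext; simp [add_mul, sum_add_distrib]
  map_smul' a c := by ext; simp [mul_assoc, mul_sum]

theorem Admissible.dof_ofCoeff (h : Admissible d k r) (c : multiIndex d k → ℝ)
    (α : multiIndex d k) : dof b k r α (ofCoeff b k c : E d → ℝ) = dofMap b k r c α := by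
  obtain ⟨c, rfl⟩ := exists_extension c
  rw [coe_ofCoeff, h.dof_baryPoly b α.2]
  exact (sum_coe_sort (multiIndex d k) fun α' => c α' * dof b k r α (baryMono b α')).symm

theorem Admissible.dofMap_injective (h : Admissible d k r) :
    Function.Injective (dofMap b k r) := by
  rw [← LinearMap.ker_eq_bot, LinearMap.ker_eq_bot']
  intro c hc
  obtain ⟨c, rfl⟩ := exists_extension c
  ext α
  refine h.coeff_eq_zero b Set.univ (fun _ _ _ _ _ _ => trivial) c (fun α hα _ => ?_) α α.2 trivial
  have h1 := h.dof_ofCoeff b (fun α => c α) ⟨α, hα⟩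
  rw [hc, coe_ofCoeff] at h1
  exact h1

/-- An injective endomorphism of the finite-dimensional coefficient space is onto. That the
monomials span is enough; their independence is not needed. -/
theorem Admissible.dof_bijective (h : Admissible d k r) :
    Function.Bijective (fun (u : polySpace d k) (α : multiIndex d k) =>
      dof b k r α (u : E d → ℝ)) := by
  have hcomp : ∀ c, (fun α : multiIndex d k => dof b k r α (ofCoeff b k c : E d → ℝ)) =
      dofMap b k r c := fun c => funext fun α => h.dof_ofCoeff b c α
  constructor
  · intro u v huv
    obtain ⟨c, rfl⟩ := ofCoeff_surjective b u
    obtain ⟨c', rfl⟩ := ofCoeff_surjective b v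
    simp only [hcomp] at huv
    rw [h.dofMap_injective b huv]
  · intro w
    obtain ⟨c, hc⟩ := LinearMap.surjective_of_injective (h.dofMap_injective b) w
    exact ⟨ofCoeff b k c, by simp only [hcomp, hc]⟩

theorem Admissible.exists_reproduces (h : Admissible d k r) :
    ∃ p : multiIndex d k → polySpace d k, Reproduces b k r p := by
  let e := LinearEquiv.ofInjectiveEndo (dofMap b k r) (h.dofMap_injective b)
  have he : ∀ c, e.symm (dofMap b k r c) = c := fun c => e.symm_apply_apply c
  refine ⟨fun α => ofCoeff b k (e.symm (Pi.single α 1)), fun u => ?_⟩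
  obtain ⟨c, rfl⟩ := ofCoeff_surjective b u
  simp_rw [h.dof_ofCoeff b c, ← map_smul, ← map_sum]
  congr 1
  rw [← he c]
  congr 1
  ext α
  simp [Pi.single_apply, he]

end Dof

/-! ### Renumbering the vertices -/

section Renumber

variable {d k : ℕ} {r : ℕ → ℕ} {α : Fin (d + 1) → ℕ} {M : Finset (Fin (d + 1))}
  (π : Equiv.Perm (Fin (d + 1)))

theorem comp_mem_multiIndex (hα : α ∈ multiIndex d k) : α ∘ π ∈ multiIndex d k := by
  rw [mem_multiIndex] at hα ⊢
  rw [← hα]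
  exact Equiv.sum_comp π α

theorem comp_mem_smallUpTo {s : ℕ} (hα : α ∈ smallUpTo d k r s) :
    α ∘ π ∈ smallUpTo d k r s := by
  refine ⟨comp_mem_multiIndex π hα.1, fun t ht hts => ?_⟩
  obtain ⟨N, hN, hs⟩ := hα.2 t ht hts
  refine ⟨N.map π.symm.toEmbedding, by rw [card_map, hN], ?_⟩
  rw [sum_map]
  simpa using hs

theorem comp_mem_smallUpTo_iff {s : ℕ} :
    α ∘ π ∈ smallUpTo d k r s ↔ α ∈ smallUpTo d k r s := by
  refine ⟨fun h => ?_, comp_mem_smallUpTo π⟩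
  have := comp_mem_smallUpTo π.symm h
  rwa [Function.comp_assoc, Equiv.self_comp_symm, Function.comp_id] at this

theorem IsDualN.comp (hM : IsDualN k r α M) : IsDualN k r (α ∘ π) (M.map π.symm.toEmbedding) := by
  refine ⟨by simpa using hM.1, ?_, ?_⟩
  · rw [card_map]
    refine ⟨comp_mem_smallUpTo π hM.2.1.1, ?_⟩
    simp only [Set.mem_iUnion, comp_mem_smallUpTo_iff]
    simpa only [Set.mem_iUnion] using hM.2.1.2
  · rw [card_map, sum_map]
    simpa using hM.2.2

theorem Admissible.mem_dualN_comp (h : Admissible d k r) (hα : α ∈ multiIndex d k)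
    (i : Fin (d + 1)) : i ∈ dualN k r (α ∘ π) ↔ π i ∈ dualN k r α := by
  rw [h.dualN_eq ((isDualN_dualN hα).comp π)]
  simp

theorem Admissible.nodeCoord_comp (h : Admissible d k r) (hα : α ∈ multiIndex d k)
    (i : Fin (d + 1)) : nodeCoord k r (α ∘ π) i = nodeCoord k r α (π i) := by
  have hN := h.dualN_eq ((isDualN_dualN (r := r) hα).comp π)
  have hcard : (dualN k r (α ∘ π)).card = (dualN k r α).card := by rw [hN, card_map]
  have ho : dualOrder k r (α ∘ π) = dualOrder k r α := by
    rw [dualOrder, hN, sum_map]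
    simp [dualOrder]
  have hs : nodeShift k r (α ∘ π) = nodeShift k r α := by simp [nodeShift, hcard, ho]
  have hD : (dualDelta k r (α ∘ π)).card = (dualDelta k r α).card := by
    rw [dualDelta, dualDelta, card_compl, card_compl, hcard]
  have hi : i ∈ dualDelta k r (α ∘ π) ↔ π i ∈ dualDelta k r α := by
    simp [dualDelta, h.mem_dualN_comp π hα]
  simp only [nodeCoord, hi, ho, hs, hD, hcard, Function.comp]

theorem outerNormal_comp (x : Fin (d + 1) → E d) (G : Finset (Fin (d + 1))) (i : Fin (d + 1)) :
    outerNormal (x ∘ π) G i = outerNormal x (G.map π.toEmbedding) (π i) := by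
  have h1 : (x ∘ π) '' (G : Set (Fin (d + 1))) =
      x '' ((G.map π.toEmbedding : Finset (Fin (d + 1))) : Set (Fin (d + 1))) := by
    rw [coe_map, Set.image_comp]
    rfl
  have h2 : heightVec (x ∘ π) G i = heightVec x (G.map π.toEmbedding) (π i) := by
    unfold heightVec
    rw [sum_map, card_map]
    simp only [h1]
    rfl
  rw [outerNormal, outerNormal, h2]

/-- Degrees of freedom do not depend on the numbering of the vertices. -/
theorem Admissible.dof_comp (h : Admissible d k r) (b : AffineBasis (Fin (d + 1)) ℝ (E d))
    (hα : α ∈ multiIndex d k) {u : E d → ℝ}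
    (hu : ContDiffOn ℝ (r d) u (convexHull ℝ (Set.range b))) :
    dof (b ∘ π) k r (α ∘ π) u = dof b k r α u := by
  have hnode : node (b ∘ π) k r (α ∘ π) = node b k r α := by
    unfold node
    rw [← Equiv.sum_comp π fun i => nodeCoord k r α i • b i]
    exact sum_congr rfl fun i _ => by rw [h.nodeCoord_comp π hα]; rfl
  have hΔ : (dualDelta k r (α ∘ π)).map π.toEmbedding = dualDelta k r α := by
    ext i
    obtain ⟨i, rfl⟩ := π.surjective i
    simp [dualDelta, h.mem_dualN_comp π hα]
  have hperm : (directions (b ∘ π) k r (α ∘ π)).Perm (directions b k r α) := by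
    have h1 : outerNormal (b ∘ π) (dualDelta k r (α ∘ π)) =
        outerNormal b (dualDelta k r α) ∘ π := by
      ext1 i
      rw [outerNormal_comp, hΔ]
      rfl
    rw [directions_eq, directions_eq, h1, ← List.map_map]
    refine List.Perm.map _ (List.perm_iff_count.2 fun i => ?_)
    obtain ⟨i, rfl⟩ := π.surjective i
    rw [List.count_map_of_injective _ _ π.injective, count_dirIndices, count_dirIndices]
    simp [h.mem_dualN_comp π hα]
  rw [dof_eq_jet, dof_eq_jet, hnode, π.surjective.range_comp]
  refine jet_perm (convex_convexHull ℝ _) (interior_simplex_nonempty b) hperm hu ?_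
    (h.node_mem b hα)
  rw [hperm.length_eq, length_directions]
  exact h.dualOrder_le_r hα

end Renumber

/-! ### Agreement on a common face -/

section Interface

variable {d k : ℕ} {r : ℕ → ℕ} {α : Fin (d + 1) → ℕ}

/-- By unisolvence some polynomial w has the degrees of freedom of u. Its reproduction formula is
the interpolant of u, whichever p is chosen. -/
theorem Admissible.dof_localInterp (h : Admissible d k r)
    (b : AffineBasis (Fin (d + 1)) ℝ (E d)) {p : multiIndex d k → polySpace d k}
    (hp : Reproduces b k r p) (u : E d → ℝ) (hα : α ∈ multiIndex d k) :
    dof b k r α (localInterp b k r p u : E d → ℝ) = dof b k r α u := by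
  obtain ⟨w, hw⟩ := (h.dof_bijective b).2 fun α => dof b k r α u
  have hw' : ∀ α : multiIndex d k, dof b k r α (w : E d → ℝ) = dof b k r α u :=
    fun α => congrFun hw α
  have : localInterp b k r p u = w := by
    rw [← hp w, localInterp]
    exact sum_congr rfl fun α _ => by rw [hw']
  rw [this]
  exact hw' ⟨α, hα⟩

variable (b b' : AffineBasis (Fin (d + 1)) ℝ (E d)) {N : Finset (Fin (d + 1))}

/-- If two simplices share the vertices not in `N`, then the degrees of freedom of the first one with
weight at most `r_1` on `N` are determined by those of the second one. -/
theorem Admissible.dof_eq_of_common_face (h : Admissible d k r) (hN : N.card ≤ d)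
    (hb : ∀ i ∉ N, b i = b' i) {Ω : Set (E d)} (hΩ : UniqueDiffOn ℝ Ω)
    (hK : convexHull ℝ (Set.range b) ⊆ Ω) (hK' : convexHull ℝ (Set.range b') ⊆ Ω)
    {u P : E d → ℝ} (hu : ContDiffOn ℝ (r d) u Ω) (hP : ContDiff ℝ (r d) P)
    (hdof : ∀ α ∈ multiIndex d k, dof b' k r α P = dof b' k r α u)
    (hα : α ∈ multiIndex d k) (hαN : ∑ i ∈ N, α i ≤ r 1) :
    dof b k r α P = dof b k r α u := by
  obtain ⟨M, hMdef⟩ : ∃ M, M = dualN k r α := ⟨_, rfl⟩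
  have hM : IsDualN k r α M := hMdef ▸ isDualN_dualN hα
  have hNM : N ⊆ M := hMdef ▸ h.subset_dualN hα hN hαN
  have hG : ∀ i ∈ Mᶜ, b i = b' i := fun i hi => hb i fun hiN => (mem_compl.1 hi) (hNM hiN)
  have hMc : Mᶜ.Nonempty := card_pos.1 (card_compl_pos hM)
  have hsum : ∑ i ∈ N, α i + ∑ i ∈ M \ N, α i = ∑ i ∈ M, α i := by
    rw [add_comm]
    exact sum_sdiff hNM
  have hord : ∑ i ∈ M, α i ≤ r d := by
    have := h.dualOrder_le_r hα
    rwa [dualOrder, ← hMdef] at this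
  have hnode : node b k r α = node b' k r α := by
    refine sum_congr rfl fun i _ => ?_
    by_cases hi : i ∈ M
    · rw [nodeCoord_of_mem (hMdef ▸ hi), zero_smul, zero_smul]
    · rw [hG i (mem_compl.2 hi)]
  have hy := h.node_mem b hα
  have hy' := h.node_mem b' hα
  have hc := convex_convexHull ℝ (Set.range b)
  have hi := interior_simplex_nonempty b
  have hc' := convex_convexHull ℝ (Set.range b')
  have hi' := interior_simplex_nonempty b'
  let l := (dirIndices N α).map (outerNormal b Mᶜ)
  let js₀ := dirIndices (M \ N) α
  have hl : l.length = ∑ i ∈ N, α i := by rw [List.length_map, length_dirIndices]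
  have hjs₀ : js₀.length = ∑ i ∈ M \ N, α i := length_dirIndices
  -- For i ∈ M \ N the vertex i and the face are common, so the two normals coincide; only the
  -- directions in `l` still belong to the first simplex.
  have hperm : (directions b k r α).Perm (l ++ js₀.map (outerNormal b' Mᶜ)) := by
    have h1 : js₀.map (outerNormal b' Mᶜ) = js₀.map (outerNormal b Mᶜ) := by
      refine List.map_congr_left fun i hi => ?_
      have := mem_sdiff.1 (mem_of_mem_dirIndices hi)
      exact (outerNormal_congr hG (hb i this.2)).symm
    rw [h1, directions_eq, dualDelta, ← hMdef, ← List.map_append]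
    refine List.Perm.map _ (List.perm_iff_count.2 fun i => ?_)
    rw [List.count_append, count_dirIndices, count_dirIndices, count_dirIndices]
    by_cases hiN : i ∈ N
    · simp [hiN, hNM hiN]
    · simp [hiN]
  have hlen : (directions b k r α).length ≤ r d := by
    rw [length_directions]
    exact h.dualOrder_le_r hα
  have hlen' : (l ++ js₀.map (outerNormal b' Mᶜ)).length ≤ r d := by
    rwa [← hperm.length_eq]
  -- Derivatives taken within either simplex are those of u on Ω, respectively of P on the whole
  -- space, so the second simplex can replace the first.
  rw [dof_eq_jet, dof_eq_jet, jet_perm hc hi hperm hP.contDiffOn hlen hy,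
    jet_perm hc hi hperm (hu.mono hK) hlen hy,
    jet_subset hK (uniqueDiffOn_simplex b) hΩ hu hlen' hy,
    jet_subset (Set.subset_univ _) (uniqueDiffOn_simplex b) uniqueDiffOn_univ hP.contDiffOn hlen' hy,
    hnode, ← jet_subset hK' (uniqueDiffOn_simplex b') hΩ hu hlen' hy',
    ← jet_subset (Set.subset_univ _) (uniqueDiffOn_simplex b') uniqueDiffOn_univ hP.contDiffOn hlen'
      hy']
  refine jet_sub_eq_zero_of_span (outerNormal b' Mᶜ) {i | i ∉ Mᶜ} hc' hi' (n := r d) hP.contDiffOn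
    (hu.mono hK') hy' l ?_ js₀ (by omega) fun js hjs hjslen => ?_
  · intro v hv
    obtain ⟨i, -, rfl⟩ := List.mem_map.1 hv
    refine mem_span_outerNormal b' hMc ?_
    rw [← faceSpan_congr hG]
    exact outerNormal_mem
  · have hmem : ∀ j ∈ js ++ js₀, j ∈ M := by
      intro j hj
      rcases List.mem_append.1 hj with hj | hj
      · simpa using hjs j hj
      · exact (mem_sdiff.1 (mem_of_mem_dirIndices hj)).1
    have hcount : ∀ i ∉ M, (js ++ js₀).count i = 0 := fun i hi =>
      List.count_eq_zero.2 fun hj => hi (hmem i hj)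
    -- The multiplicities of the new directions. They contain those of `js₀`, so no component on M \
    -- N has decreased, and the total on M is unchanged.
    let α' : Fin (d + 1) → ℕ := fun i => if i ∈ M then (js ++ js₀).count i else α i
    have hαM : ∀ i ∈ M, α' i = (js ++ js₀).count i := fun i hi => if_pos hi
    have hαoff : ∀ i ∉ M, α' i = α i := fun i hi => if_neg hi
    have hsumM : ∑ i ∈ M, α' i = ∑ i ∈ M, α i := by
      rw [sum_congr rfl hαM, sum_subset (subset_univ M) fun i _ hi => hcount i hi,
        ← length_eq_sum_count, List.length_append, hjslen, hl, hjs₀, hsum]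
    have hα' : α' ∈ multiIndex d k := by
      rw [mem_multiIndex, ← sum_add_sum_compl M, hsumM,
        sum_congr rfl fun i hi => hαoff i (mem_compl.1 hi), sum_add_sum_compl]
      exact mem_multiIndex.1 hα
    have hM' : IsDualN k r α' M := by
      refine h.isDualN_of_move hM hNM hαN hα' hαoff fun i hiM hiN => ?_
      rw [hαM i hiM, List.count_append, count_dirIndices, if_pos (mem_sdiff.2 ⟨hiM, hiN⟩)]
      exact Nat.le_add_left _ _
    have hN' := h.dualN_eq hM'
    have hnode' : node b' k r α' = node b' k r α := by
      have hnc : nodeCoord k r α' = nodeCoord k r α :=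
        nodeCoord_congr (hN'.trans hMdef) (by rwa [← hMdef]) (by rwa [← hMdef])
      rw [node, node, hnc]
    have hperm' : ((js ++ js₀).map (outerNormal b' Mᶜ)).Perm (directions b' k r α') := by
      rw [directions_eq, dualDelta, hN']
      refine List.Perm.map _ (List.perm_iff_count.2 fun i => ?_)
      rw [count_dirIndices]
      split_ifs with hi
      · exact (hαM i hi).symm
      · exact hcount i hi
    have hlen'' : ((js ++ js₀).map (outerNormal b' Mᶜ)).length ≤ r d := by
      rw [hperm'.length_eq, length_directions]
      exact h.dualOrder_le_r hα'
    rw [jet_perm hc' hi' hperm' hP.contDiffOn hlen'' hy',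
      jet_perm hc' hi' hperm' (hu.mono hK') hlen'' hy', ← hnode']
    exact hdof α' hα'

theorem iteratedFDeriv_eq_of_jet {V : Type*} [NormedAddCommGroup V] [NormedSpace ℝ V]
    {f g : V → ℝ} {y : V} {m : ℕ}
    (hfg : ∀ l : List V, l.length = m → jet Set.univ f l y = jet Set.univ g l y) :
    iteratedFDeriv ℝ m f y = iteratedFDeriv ℝ m g y := by
  ext v
  have key : ∀ (n : ℕ) (hn : n = m) (F : V → ℝ), iteratedFDeriv ℝ n F y (fun i => v (i.cast hn)) =
      iteratedFDeriv ℝ m F y v := by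
    rintro n rfl F
    rfl
  have h1 : ∀ F : V → ℝ, jet Set.univ F (List.ofFn v) y = iteratedFDeriv ℝ m F y v := by
    intro F
    rw [← key _ (List.length_ofFn (f := v)) F, jet, iteratedFDerivWithin_univ]
    congr 1
    ext1 i
    exact List.get_ofFn v i
  rw [← h1, ← h1]
  exact hfg _ List.length_ofFn

/-- The interpolants on two simplices have the same derivatives up to order `r_1` on the common
face. -/
theorem Admissible.iteratedFDeriv_eq_of_common_face (h : Admissible d k r) (hd : 1 ≤ d)
    (hN : N.card ≤ d) (hb : ∀ i ∉ N, b i = b' i) {Ω : Set (E d)} (hΩ : UniqueDiffOn ℝ Ω)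
    (hK : convexHull ℝ (Set.range b) ⊆ Ω) (hK' : convexHull ℝ (Set.range b') ⊆ Ω)
    {u : E d → ℝ} (hu : ContDiffOn ℝ (r d) u Ω) {P P' : E d → ℝ} (hP : P ∈ polySpace d k)
    (hP' : P' ∈ polySpace d k)
    (hdof : ∀ α ∈ multiIndex d k, dof b k r α P = dof b k r α u)
    (hdof' : ∀ α ∈ multiIndex d k, dof b' k r α P' = dof b' k r α u)
    {y : E d} (hy : ∀ i ∈ N, b.coord i y = 0) {m : ℕ} (hm : m ≤ r 1) :
    iteratedFDeriv ℝ m P y = iteratedFDeriv ℝ m P' y := by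
  have hr : r 1 ≤ r d := h.mono le_rfl hd le_rfl
  obtain ⟨c, hc⟩ := exists_baryPoly_eq b ((polySpace d k).sub_mem hP hP')
  have hcP : (fun z => P z - P' z) = baryPoly b k c := hc
  have hPs := polySpace_contDiff hP (r d) b
  have hPs' := polySpace_contDiff hP' (r d) b
  -- The set is lower closed because N ⊆ N'(α) for each of its members.
  have hzero := h.coeff_eq_zero b {α | ∑ i ∈ N, α i ≤ r 1}
    (fun α hα hαA α' _ hle => (sum_le_sum fun i hi =>
      hle i (h.subset_dualN hα hN hαA hi)).trans hαA) c fun α hα hαA => by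
      rw [← hcP, dof_eq_jet, jet_sub (uniqueDiffOn_simplex b) hPs.contDiffOn hPs'.contDiffOn
        (by rw [length_directions]; exact h.dualOrder_le_r hα) (h.node_mem b hα), ← dof_eq_jet,
        ← dof_eq_jet, hdof α hα,
        h.dof_eq_of_common_face b b' hN hb hΩ hK hK' hu hPs' hdof' hα hαA, sub_self]
  refine iteratedFDeriv_eq_of_jet fun l hl => ?_
  rw [← sub_eq_zero, ← jet_sub uniqueDiffOn_univ hPs.contDiffOn hPs'.contDiffOn (by omega)
    (Set.mem_univ y), hcP, jet_baryPoly b convex_univ (by simp) (Set.mem_univ y)]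
  refine sum_eq_zero fun α hα => ?_
  by_cases hαA : ∑ i ∈ N, α i ≤ r 1
  · rw [hzero α hα hαA, zero_mul]
  · rw [jet_baryMono_eq_zero_of_length_lt b convex_univ (by simp) (Set.mem_univ y) hy l (by omega),
      mul_zero]

end Interface

/-! ### Piecewise smooth functions -/

section Glue

open Filter Topology

/-- A function that is given on each set of a locally finite closed cover by a smooth function is
smooth if the derivatives of the pieces agree. -/
theorem exists_contDiffOn_iUnion {V : Type*} [NormedAddCommGroup V] [NormedSpace ℝ V] {ι : Type*}
    {S : ι → Set V} (hS : LocallyFinite S) (hcl : ∀ i, IsClosed (S i)) {n : ℕ} {P : ι → V → ℝ}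
    (hP : ∀ i, ContDiff ℝ n (P i))
    (h : ∀ i j, ∀ y ∈ S i, y ∈ S j → ∀ m ≤ n,
      iteratedFDeriv ℝ m (P i) y = iteratedFDeriv ℝ m (P j) y) :
    ∃ v : V → ℝ, (∀ i, ∀ y ∈ S i, v y = P i y) ∧ ContDiffOn ℝ n v (⋃ i, S i) := by
  classical
  -- Any piece containing y may be chosen: the derivatives up to order n do not depend on the
  -- choice.
  let F : V → V → ℝ := fun y => if hy : ∃ i, y ∈ S i then P hy.choose else 0
  let p : V → FormalMultilinearSeries ℝ V ℝ := fun y => ftaylorSeries ℝ (F y) y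
  have hp : ∀ i, ∀ y ∈ S i, ∀ m ≤ n, p y m = iteratedFDeriv ℝ m (P i) y := by
    intro i y hy m hm
    have hex : ∃ i, y ∈ S i := ⟨i, hy⟩
    have hF : F y = P hex.choose := dif_pos hex
    change iteratedFDeriv ℝ m (F y) y = _
    rw [hF]
    exact h _ _ y hex.choose_spec hy m hm
  have hv : ∀ i, ∀ y ∈ S i, F y y = P i y := by
    intro i y hy
    have := congrArg (fun q => q 0) (hp i y hy 0 (Nat.zero_le _))
    simpa [p, ftaylorSeries] using this
  -- By local finiteness the neighborhood filter within the union is the supremum of those within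
  -- the pieces, and closed pieces missing y contribute nothing. Derivatives and continuity are thus
  -- checked piece by piece.
  have hnhds : ∀ i y, y ∉ S i → 𝓝[S i] y = ⊥ := fun i y hy => by
    by_contra hne
    rw [← ne_eq, ← neBot_iff, ← mem_closure_iff_nhdsWithin_neBot, (hcl i).closure_eq] at hne
    exact hy hne
  refine ⟨fun y => F y y, hv, ?_⟩
  have ht : HasFTaylorSeriesUpToOn n (fun y => F y y) p (⋃ i, S i) := by
    refine ⟨fun y _ => ?_, fun m hm y hy => ?_, fun m hm y hy => ?_⟩
    · simp [p, ftaylorSeries]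
    · have hm : m < n := by exact_mod_cast hm
      rw [hasFDerivWithinAt_iff_isLittleO, hS.nhdsWithin_iUnion, Asymptotics.isLittleO_iff]
      intro c hc
      rw [eventually_iSup]
      intro i
      by_cases hyi : y ∈ S i
      · have h1 := ((hP i).ftaylorSeries.fderiv m (by exact_mod_cast hm) y).hasFDerivWithinAt
          (s := S i)
        have h2 : HasFDerivWithinAt (p · m) (p y m.succ).curryLeft (S i) y := by
          rw [hp i y hyi _ hm]
          exact h1.congr (fun z hz => hp i z hz m hm.le) (hp i y hyi m hm.le)
        exact (Asymptotics.isLittleO_iff.1 h2.isLittleO) hc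
      · rw [hnhds i y hyi]
        exact eventually_bot
    · have hm : m ≤ n := by exact_mod_cast hm
      rw [ContinuousWithinAt, hS.nhdsWithin_iUnion, tendsto_iSup]
      intro i
      by_cases hyi : y ∈ S i
      · have h1 := ((hP i).ftaylorSeries.cont m (by exact_mod_cast hm)).continuousWithinAt
          (s := S i) (x := y)
        exact h1.congr (fun z hz => hp i z hz m hm) (hp i y hyi m hm)
      · rw [hnhds i y hyi]
        exact tendsto_bot
  exact_mod_cast HasFTaylorSeriesUpToOn.contDiffOn (n := (n : ℕ∞)) (by exact_mod_cast ht)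

end Glue

/-! ### Meshes -/

section Mesh

variable {d k : ℕ} {r : ℕ → ℕ} {T : Geometry.SimplicialComplex ℝ (E d)}

theorem injective_of_range_eq {K : Finset (E d)} (hK : K.card = d + 1) {x : Fin (d + 1) → E d}
    (hx : Set.range x = (K : Set (E d))) : Function.Injective x := by
  classical
  have h1 : univ.image x = K := by
    rw [← coe_inj, coe_image, coe_univ, Set.image_univ, hx]
  have h2 : Set.InjOn x (univ : Finset (Fin (d + 1))) :=
    card_image_iff.1 (by rw [h1, hK, card_univ, Fintype.card_fin])
  exact fun i j hij => h2 (by simp) (by simp) hij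

theorem affineIndependent_of_mem_cells {K : Finset (E d)} (hK : K ∈ cells T)
    {x : Fin (d + 1) → E d} (hx : Set.range x = (K : Set (E d))) : AffineIndependent ℝ x := by
  have hinj := injective_of_range_eq hK.2 hx
  have hmem : ∀ i, x i ∈ K := fun i => by
    have : x i ∈ Set.range x := ⟨i, rfl⟩
    rwa [hx] at this
  have hf : K ∈ T.faces := hK.1
  let f : Fin (d + 1) ↪ K := ⟨fun i => ⟨x i, hmem i⟩, fun i j hij => hinj (congrArg Subtype.val hij)⟩
  have hxf : x = (fun v : K => (v : E d)) ∘ f := rfl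
  rw [hxf]
  exact (T.indep hf).comp_embedding f

theorem IsMesh.space_eq (hT : IsMesh T) :
    T.space = ⋃ K : cells T, convexHull ℝ ((K : Finset (E d)) : Set (E d)) := by
  ext y
  rw [T.mem_space_iff, Set.mem_iUnion]
  constructor
  · rintro ⟨s, hs, hy⟩
    obtain ⟨t, ht, hst⟩ := hT.subset_cell s hs
    exact ⟨⟨t, ht⟩, convexHull_mono (by exact_mod_cast hst) hy⟩
  · rintro ⟨K, hy⟩
    exact ⟨K, K.2.1, hy⟩

theorem IsMesh.uniqueDiffOn (hT : IsMesh T) {x : cells T → Fin (d + 1) → E d}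
    (hx : ∀ K : cells T, Set.range (x K) = ((K : Finset (E d)) : Set (E d))) :
    UniqueDiffOn ℝ T.space := by
  intro y hy
  rw [hT.space_eq, Set.mem_iUnion] at hy
  obtain ⟨K, hy⟩ := hy
  let b := simplexBasis (x K) (affineIndependent_of_mem_cells K.2 (hx K))
  have hb : convexHull ℝ (Set.range b) = convexHull ℝ ((K : Finset (E d)) : Set (E d)) := by
    rw [← hx K]
    rfl
  refine (uniqueDiffOn_simplex b y (hb ▸ hy)).mono ?_
  rw [hb]
  exact T.convexHull_subset_space K.2.1

/-- The vertices of the second simplex can be renumbered so that the common vertices of two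
simplices get the same numbers. -/
theorem exists_perm_common {x x' : Fin (d + 1) → E d} (hx : Function.Injective x)
    (hx' : Function.Injective x') :
    ∃ π : Equiv.Perm (Fin (d + 1)), ∀ i, x i ∈ Set.range x' → x' (π i) = x i := by
  classical
  let e : {i // x i ∈ Set.range x'} → {i // x' i ∈ Set.range x} :=
    fun i => ⟨i.2.choose, by rw [i.2.choose_spec]; exact ⟨i, rfl⟩⟩
  have he : ∀ i, x' (e i) = x i := fun i => i.2.choose_spec
  have hbij : Function.Bijective e := by
    constructor
    · intro i j hij
      refine Subtype.ext (hx ?_)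
      rw [← he, ← he, hij]
    · rintro ⟨j, i, hij⟩
      refine ⟨⟨i, j, hij.symm⟩, Subtype.ext (hx' ?_)⟩
      rw [he]
      exact hij
  refine ⟨(Equiv.ofBijective e hbij).extendSubtype, fun i hi => ?_⟩
  rw [Equiv.extendSubtype_apply_of_mem _ i hi]
  exact he ⟨i, hi⟩

theorem Admissible.iteratedFDeriv_localInterp_eq (h : Admissible d k r) (hd : 1 ≤ d)
    (hT : IsMesh T) {x : cells T → Fin (d + 1) → E d}
    (hx : ∀ K : cells T, Set.range (x K) = ((K : Finset (E d)) : Set (E d)))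
    {p : cells T → multiIndex d k → polySpace d k}
    (hp : ∀ K : cells T, Reproduces (x K) k r (p K)) {u : E d → ℝ}
    (hu : ContDiffOn ℝ (r d) u T.space) (K K' : cells T) {y : E d}
    (hy : y ∈ convexHull ℝ ((K : Finset (E d)) : Set (E d)))
    (hy' : y ∈ convexHull ℝ ((K' : Finset (E d)) : Set (E d))) {m : ℕ} (hm : m ≤ r 1) :
    iteratedFDeriv ℝ m (localInterp (x K) k r (p K) u : E d → ℝ) y =
      iteratedFDeriv ℝ m (localInterp (x K') k r (p K') u : E d → ℝ) y := by
  classical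
  have hxi := injective_of_range_eq K.2.2 (hx K)
  have hxi' := injective_of_range_eq K'.2.2 (hx K')
  obtain ⟨π, hπ⟩ := exists_perm_common hxi hxi'
  let b := simplexBasis (x K) (affineIndependent_of_mem_cells K.2 (hx K))
  let b₀ := simplexBasis (x K') (affineIndependent_of_mem_cells K'.2 (hx K'))
  let b' := b₀.reindex π.symm
  have hb' : ⇑b' = b₀ ∘ π := by
    rw [AffineBasis.coe_reindex]
    rfl
  have hbr : Set.range b = ((K : Finset (E d)) : Set (E d)) := hx K
  have hbr₀ : Set.range b₀ = ((K' : Finset (E d)) : Set (E d)) := hx K'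
  have hbr' : Set.range b' = Set.range b₀ := by rw [hb', π.surjective.range_comp]
  -- In a simplicial complex y lies in the hull of the common vertices. This makes N a proper subset
  -- of the indices and makes λ_i vanish at y for i ∈ N.
  have hyF := T.inter_subset_convexHull K.2.1 K'.2.1 ⟨hy, hy'⟩
  let N : Finset (Fin (d + 1)) := univ.filter fun i => x K i ∉ Set.range (x K')
  have hNmem : ∀ i, i ∉ N ↔ x K i ∈ Set.range (x K') := fun i => by simp [N]
  have hN : N.card ≤ d := by
    obtain ⟨z, hz, hz'⟩ := convexHull_nonempty_iff.1 ⟨y, hyF⟩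
    rw [← hx K] at hz
    rw [← hx K'] at hz'
    obtain ⟨i, rfl⟩ := hz
    have hlt : N.card < (univ : Finset (Fin (d + 1))).card :=
      card_lt_card (ssubset_univ_iff.2 fun hu => (hNmem i).2 hz' (hu ▸ mem_univ i))
    rw [card_univ, Fintype.card_fin] at hlt
    omega
  have hyN : ∀ i ∈ N, b.coord i y = 0 := by
    intro i hi
    have hsub : ((K : Finset (E d)) : Set (E d)) ∩ ((K' : Finset (E d)) : Set (E d)) ⊆
        b.coord i ⁻¹' {0} := by
      rintro z ⟨hz, hz'⟩
      rw [← hx K] at hz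
      rw [← hx K'] at hz'
      obtain ⟨j, rfl⟩ := hz
      have hij : i ≠ j := fun hij => (hNmem j).2 hz' (hij ▸ hi)
      exact b.coord_apply_ne hij
    exact convexHull_min hsub (Convex.affine_preimage (𝕜 := ℝ) (b.coord i) (convex_singleton 0)) hyF
  have hK : convexHull ℝ (Set.range b) ⊆ T.space := by
    rw [hbr]
    exact T.convexHull_subset_space K.2.1
  have hK₀ : convexHull ℝ (Set.range b₀) ⊆ T.space := by
    rw [hbr₀]
    exact T.convexHull_subset_space K'.2.1
  refine h.iteratedFDeriv_eq_of_common_face b b' hd hN (fun i hi => ?_) (hT.uniqueDiffOn hx) hK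
    (by rwa [hbr']) hu (localInterp (x K) k r (p K) u).2 (localInterp (x K') k r (p K') u).2
    (fun α hα => h.dof_localInterp b (hp K) u hα) (fun α hα => ?_) hyN hm
  · rw [hb']
    exact (hπ i ((hNmem i).1 hi)).symm
  · have hα' := comp_mem_multiIndex π.symm hα
    have hcomp : (α ∘ π.symm) ∘ π = α := by
      rw [Function.comp_assoc, Equiv.symm_comp_self, Function.comp_id]
    have hpoly : ContDiffOn ℝ (r d) (localInterp (x K') k r (p K') u : E d → ℝ)
        (convexHull ℝ (Set.range b₀)) :=
      (polySpace_contDiff (localInterp (x K') k r (p K') u).2 _ b₀).contDiffOn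
    rw [hb', ← hcomp, h.dof_comp π b₀ hα' hpoly, h.dof_comp π b₀ hα' (hu.mono hK₀)]
    exact h.dof_localInterp b₀ (hp K') u hα'

end Mesh

end CrInterp

end

theorem theorem3p1 (d k : ℕ) (hd : 1 ≤ d) (r : ℕ → ℕ)
    (hr : ∀ i, 1 ≤ i → i < d → 2 * r i ≤ r (i + 1)) (hk : 2 * r d + 1 ≤ k) :
    -- on each simplex: unisolvence, and existence of the polynomials `p_α`
    (∀ x : Fin (d + 1) → CrInterp.E d, AffineIndependent ℝ x →
      Function.Bijective (fun (u : CrInterp.polySpace d k) (α : CrInterp.multiIndex d k) =>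
          CrInterp.dof x k r α (u : CrInterp.E d → ℝ)) ∧
        ∃ p : CrInterp.multiIndex d k → CrInterp.polySpace d k, CrInterp.Reproduces x k r p) ∧
    -- on each mesh (vertices of each element numbered in any way by `x`): the piecewise
    -- interpolant `v` is well defined and of class `C^{r_1}`
    ∀ T : Geometry.SimplicialComplex ℝ (CrInterp.E d), CrInterp.IsMesh T →
      ∀ x : CrInterp.cells T → Fin (d + 1) → CrInterp.E d,
      (∀ K : CrInterp.cells T, Set.range (x K) = ((K : Finset (CrInterp.E d)) : Set _)) →
      ∀ p : CrInterp.cells T → CrInterp.multiIndex d k → CrInterp.polySpace d k,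
      (∀ K : CrInterp.cells T, CrInterp.Reproduces (x K) k r (p K)) →
      ∀ u : CrInterp.E d → ℝ, ContDiffOn ℝ (r d) u T.space →
        ∃ v : CrInterp.E d → ℝ,
          (∀ K : CrInterp.cells T, ∀ y ∈ convexHull ℝ ((K : Finset (CrInterp.E d)) : Set _),
            v y = (CrInterp.localInterp (x K) k r (p K) u : CrInterp.E d → ℝ) y) ∧
          ContDiffOn ℝ (r 1) v T.space := by
  have h : CrInterp.Admissible d k r := ⟨hr, hk⟩
  refine ⟨fun x hx => ⟨h.dof_bijective (CrInterp.simplexBasis x hx),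
    h.exists_reproduces (CrInterp.simplexBasis x hx)⟩, fun T hT x hx p hp u hu => ?_⟩
  rw [hT.space_eq]
  exact CrInterp.exists_contDiffOn_iUnion hT.locallyFinite
    (fun K => (Finset.finite_toSet (K : Finset (CrInterp.E d))).isClosed_convexHull ℝ)
    (fun K => CrInterp.polySpace_contDiff (CrInterp.localInterp (x K) k r (p K) u).2 _
      (CrInterp.simplexBasis (x K) (CrInterp.affineIndependent_of_mem_cells K.2 (hx K))))
    fun K K' y hy hy' m hm => h.iteratedFDeriv_localInterp_eq hd hT hx hp hu K K' hy hy' hm
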